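/- Let $Z_2=\mathrm{Tot}(\mathcal O_{\mathbb P^1}(-2))$ be the complex surface glued from two affine planes $U$ with coordinates $(z,u)$ and $V$ with coordinates $(\xi,v)$ along $\{z\neq 0\}\cong\{\xi\neq 0\}$ by $\xi=z^{-1}$, $v=z^2u$. Let $X_2=\mathrm{Spec}\,A$ with $A=\mathbb C[x,y,w]/(y^2-xw)$ be the $A_1$ surface singularity, and let $\pi\colon Z_2\to X_2$ be the contraction of the zero section, given by $(x,y,w)=(u,zu,z^2u)$ on $U$ and $(x,y,w)=(\xi^2v,\xi v,v)$ on $V$. Let $\mathcal O(-3)$ be the line bundle on $Z_2$ with transition function $z^3$, so that a section is a pair of functions $a$ on $U$ and $b$ on $V$ with $b=z^3a$ on the overlap, and put $\mathcal F=\pi_*\mathcal O(-3)$. Let $D_{Sg}(X_2)=D^b(\mathrm{coh}\,X_2)/\mathrm{Perf}(X_2)$ be the singularity category, where $\mathrm{Perf}(X_2)$ consists of the objects isomorphic to bounded complexes of locally free sheaves of finite rank. Then: 1. $\mathcal F$ is a coherent sheaf of rank one. 2. $\mathcal F$ has an infinite periodic resolution $$\cdots\xrightarrow{\ \varphi\ }\mathcal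 O_{X_2}^{2}\xrightarrow{\ \varphi\ }\mathcal O_{X_2}^{2}\xrightarrow{\ \varphi\ }\mathcal O_{X_2}^{2}\longrightarrow\mathcal F\longrightarrow 0,\qquad \varphi=\begin{pmatrix}y&w\\-x&-y\end{pmatrix},$$ that is, the sequence is exact; all differentials are equal to $\varphi$, so in particular it is $2$-periodic. 3. $\mathcal F$ is not perfect, and its image in $D_{Sg}(X_2)$ is nonzero. 4. $\mathcal F$ generates $D_{Sg}(X_2)$: the only strictly full triangulated subcategory of $D_{Sg}(X_2)$ containing the image of $\mathcal F$ is $D_{Sg}(X_2)$ itself. -/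

import Mathlib

open CategoryTheory Limits AlgebraicGeometry TopologicalSpace

namespace A1Singularity

noncomputable section

/-- The coordinate ring of each of the two charts of `Tot 𝒪(-2)`: the variables `X 0`, `X 1` are
`z, u` on the first chart `U` and `ξ, v` on the second chart `V`. -/
abbrev P : Type := MvPolynomial (Fin 2) ℂ

/-- The coordinate ring `ℂ[z, z⁻¹, u]` of the overlap, in the coordinates of `U`. -/
abbrev Pz : Type := Localization.Away (MvPolynomial.X 0 : P)

/-- The invertible coordinate `z` on the overlap. -/
def zUnit : Pzˣ := (IsLocalization.Away.algebraMap_isUnit (S := Pz) (MvPolynomial.X 0 : P)).unit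

/-- The change of coordinates `ξ ↦ z⁻¹`, `v ↦ z² u`. -/
def transPoly : P →ₐ[ℂ] Pz :=
  MvPolynomial.aeval ![((zUnit⁻¹ : Pzˣ) : Pz), (zUnit : Pz) ^ 2 * algebraMap P Pz (MvPolynomial.X 1)]

lemma transPoly_X0 : transPoly (MvPolynomial.X 0) = ((zUnit⁻¹ : Pzˣ) : Pz) := by
  simp [transPoly]
lemma transPoly_X1 : transPoly (MvPolynomial.X 1) = (zUnit : Pz) ^ 2 * algebraMap P Pz (MvPolynomial.X 1) := by
  simp [transPoly]

lemma algebraMap_X0 : algebraMap P Pz (MvPolynomial.X 0) = (zUnit : Pz) := rfl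

/-- The extension of the change of coordinates to `ℂ[ξ, ξ⁻¹, v]`. -/
def transAux : Pz →ₐ[ℂ] Pz :=
  IsLocalization.liftAlgHom (M := Submonoid.powers (MvPolynomial.X 0 : P)) (f := transPoly) (by
    rintro ⟨_, n, rfl⟩
    simp only [map_pow, transPoly_X0]
    exact (zUnit⁻¹).isUnit.pow n)

lemma transAux_algebraMap (p : P) : transAux (algebraMap P Pz p) = transPoly p := by
  simp [transAux]

lemma transAux_z : transAux (zUnit : Pz) = ((zUnit⁻¹ : Pzˣ) : Pz) := by
  rw [← algebraMap_X0, transAux_algebraMap, transPoly_X0]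

lemma transAux_zinv : transAux ((zUnit⁻¹ : Pzˣ) : Pz) = zUnit := by
  have h : transAux ((zUnit⁻¹ : Pzˣ) : Pz) * transAux (zUnit : Pz) = 1 := by
    rw [← map_mul, Units.inv_mul, map_one]
  rw [transAux_z] at h
  exact Units.mul_inv_eq_one.1 h

lemma transAux_comp : transAux.comp transAux = AlgHom.id ℂ Pz := by
  refine IsLocalization.algHom_ext (Submonoid.powers (MvPolynomial.X 0 : P)) ?_
  refine MvPolynomial.algHom_ext fun i ↦ ?_
  change transAux (transAux (algebraMap P Pz (MvPolynomial.X i))) =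
    algebraMap P Pz (MvPolynomial.X i)
  fin_cases i
  · change transAux (transAux (algebraMap P Pz (MvPolynomial.X 0))) =
      algebraMap P Pz (MvPolynomial.X 0)
    rw [transAux_algebraMap, transPoly_X0, transAux_zinv, algebraMap_X0]
  · change transAux (transAux (algebraMap P Pz (MvPolynomial.X 1))) =
      algebraMap P Pz (MvPolynomial.X 1)
    rw [transAux_algebraMap, transPoly_X1, map_mul, map_pow, transAux_z, transAux_algebraMap,
      transPoly_X1, ← mul_assoc, ← mul_pow, Units.inv_mul, one_pow, one_mul]

/-- The change of coordinates `ξ ↦ z⁻¹`, `v ↦ z² u`, as an isomorphism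
`ℂ[ξ, ξ⁻¹, v] ≃ ℂ[z, z⁻¹, u]`. -/
def transEquiv : Pz ≃ₐ[ℂ] Pz := AlgEquiv.ofAlgHom transAux transAux transAux_comp transAux_comp

/-- The ideal `(y² - x w)` of `ℂ[x, y, w]`. -/
abbrev relIdeal : Ideal (MvPolynomial (Fin 3) ℂ) :=
  Ideal.span {MvPolynomial.X 1 ^ 2 - MvPolynomial.X 0 * MvPolynomial.X 2}

/-- The ring `ℂ[x, y, w] / (y² - x w)`. -/
abbrev A : Type := MvPolynomial (Fin 3) ℂ ⧸ relIdeal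

/-- The coordinate `x`. -/
def x : A := Ideal.Quotient.mk relIdeal (MvPolynomial.X 0)

/-- The coordinate `y`. -/
def y : A := Ideal.Quotient.mk relIdeal (MvPolynomial.X 1)

/-- The coordinate `w`. -/
def w : A := Ideal.Quotient.mk relIdeal (MvPolynomial.X 2)

/-- The contraction on `U`: `x ↦ u`, `y ↦ z u`, `w ↦ z² u`. -/
def contractU : A →ₐ[ℂ] P :=
  Ideal.Quotient.liftₐ relIdeal
    (MvPolynomial.aeval ![MvPolynomial.X 1, MvPolynomial.X 0 * MvPolynomial.X 1,
      MvPolynomial.X 0 ^ 2 * MvPolynomial.X 1]) (by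
    intro a ha
    rw [← RingHom.mem_ker]
    revert a
    rw [← SetLike.le_def, Ideal.span_singleton_le_iff_mem, RingHom.mem_ker]
    simp
    ring)

/-- The contraction on `V`: `x ↦ ξ² v`, `y ↦ ξ v`, `w ↦ v`. -/
def contractV : A →ₐ[ℂ] P :=
  Ideal.Quotient.liftₐ relIdeal
    (MvPolynomial.aeval ![MvPolynomial.X 0 ^ 2 * MvPolynomial.X 1,
      MvPolynomial.X 0 * MvPolynomial.X 1, MvPolynomial.X 1]) (by
    intro a ha
    rw [← RingHom.mem_ker]
    revert a
    rw [← SetLike.le_def, Ideal.span_singleton_le_iff_mem, RingHom.mem_ker]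
    simp
    ring)

lemma contractU_x : contractU x = MvPolynomial.X 1 := by
  exact MvPolynomial.aeval_X (R := ℂ) _ (0 : Fin 3)

lemma contractU_y : contractU y = MvPolynomial.X 0 * MvPolynomial.X 1 := by
  exact MvPolynomial.aeval_X (R := ℂ) _ (1 : Fin 3)

lemma contractU_w : contractU w = MvPolynomial.X 0 ^ 2 * MvPolynomial.X 1 := by
  exact MvPolynomial.aeval_X (R := ℂ) _ (2 : Fin 3)

lemma contractV_x : contractV x = MvPolynomial.X 0 ^ 2 * MvPolynomial.X 1 := by
  exact MvPolynomial.aeval_X (R := ℂ) _ (0 : Fin 3)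

lemma contractV_y : contractV y = MvPolynomial.X 0 * MvPolynomial.X 1 := by
  exact MvPolynomial.aeval_X (R := ℂ) _ (1 : Fin 3)

lemma contractV_w : contractV w = MvPolynomial.X 1 := by
  exact MvPolynomial.aeval_X (R := ℂ) _ (2 : Fin 3)

/-- An affine chart of `Tot 𝒪(-2)`, isomorphic to the affine plane. -/
abbrev chart : Scheme.{0} := Spec (.of P)

/-- The overlap of the two charts. -/
abbrev overlap : Scheme.{0} := Spec (.of Pz)

/-- The `A₁` surface singularity `Spec ℂ[x, y, w] / (y² - x w)`. -/
abbrev X₂ : Scheme.{0} := Spec (.of A)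

/-- The inclusion of the overlap into `U`. -/
def overlapToU : overlap ⟶ chart := Spec.map (CommRingCat.ofHom (algebraMap P Pz))

/-- The inclusion of the overlap into `V`. -/
def overlapToV : overlap ⟶ chart :=
  Spec.map (CommRingCat.ofHom (transEquiv : Pz →+* Pz)) ≫
    Spec.map (CommRingCat.ofHom (algebraMap P Pz))

instance : IsOpenImmersion overlapToU :=
  IsOpenImmersion.of_isLocalization (MvPolynomial.X 0 : P)

instance : IsOpenImmersion overlapToV := by
  have : IsIso (CommRingCat.ofHom (transEquiv : Pz →+* Pz)) :=
    (transEquiv.toRingEquiv.toCommRingCatIso).isIso_hom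
  have : IsOpenImmersion (Spec.map (CommRingCat.ofHom (algebraMap P Pz))) :=
    IsOpenImmersion.of_isLocalization (MvPolynomial.X 0 : P)
  unfold overlapToV
  infer_instance

/-- The surface `Tot 𝒪(-2)` over the projective line, glued from its two charts. -/
def Z₂ : Scheme.{0} := pushout overlapToU overlapToV

/-- The chart `U`. -/
def ιU : chart ⟶ Z₂ := pushout.inl _ _

/-- The chart `V`. -/
def ιV : chart ⟶ Z₂ := pushout.inr _ _

lemma ι_condition : overlapToV ≫ ιV = overlapToU ≫ ιU := pushout.condition.symm

lemma contract_condition : overlapToU ≫ Spec.map (CommRingCat.ofHom (contractU : A →+* P)) =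
    overlapToV ≫ Spec.map (CommRingCat.ofHom (contractV : A →+* P)) := by
  have key : (Algebra.algHom ℂ P Pz).comp contractU = 
     (transEquiv : Pz →ₐ[ℂ] Pz).comp ((Algebra.algHom ℂ P Pz).comp contractV) := by
    refine Ideal.Quotient.algHom_ext _ (MvPolynomial.algHom_ext fun i ↦ ?_)
    change algebraMap P Pz (contractU (Ideal.Quotient.mk relIdeal (MvPolynomial.X i))) =
      transAux (algebraMap P Pz (contractV (Ideal.Quotient.mk relIdeal (MvPolynomial.X i))))
    rw [transAux_algebraMap]
    have h0 : ((zUnit⁻¹ : Pzˣ) : Pz) * (zUnit : Pz) = 1 := zUnit.inv_mul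
    fin_cases i
    · change algebraMap P Pz (contractU x) = transPoly (contractV x)
      rw [contractU_x, contractV_x, map_mul, map_pow, transPoly_X0, transPoly_X1, ← mul_assoc,
        ← mul_pow, h0, one_pow, one_mul]
    · change algebraMap P Pz (contractU y) = transPoly (contractV y)
      rw [contractU_y, contractV_y, map_mul, map_mul, transPoly_X0, transPoly_X1, ← mul_assoc,
        pow_two, ← mul_assoc, h0, one_mul, algebraMap_X0]
    · change algebraMap P Pz (contractU w) = transPoly (contractV w)
      rw [contractU_w, contractV_w, map_mul, map_pow, transPoly_X1, algebraMap_X0]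
  simp only [overlapToU, overlapToV, ← Spec.map_comp]
  congr 1
  exact CommRingCat.hom_ext (congrArg AlgHom.toRingHom key)

/-- The contraction of the zero section of `Tot 𝒪(-2)`. -/
def π : Z₂ ⟶ X₂ := pushout.desc _ _ contract_condition

/-- The structure sheaf as a sheaf of modules. -/
abbrev 𝒪 (X : Scheme.{0}) : X.Modules := SheafOfModules.unit X.ringCatSheaf

/-- The map `𝒪_Y ⟶ f_* 𝒪_X` given by pulling back functions along `f`. -/
def structureMap {X Y : Scheme.{0}} (f : X ⟶ Y) : 𝒪 Y ⟶ (Scheme.Modules.pushforward f).obj (𝒪 X) :=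
  SheafOfModules.unitToPushforwardObjUnit f.toRingCatSheafHom

/-- Restriction of functions from `U` to the overlap. -/
def resU : (Scheme.Modules.pushforward ιU).obj (𝒪 chart) ⟶
    (Scheme.Modules.pushforward (overlapToU ≫ ιU)).obj (𝒪 overlap) :=
  (Scheme.Modules.pushforward ιU).map (structureMap overlapToU) ≫
    (Scheme.Modules.pushforwardComp overlapToU ιU).hom.app (𝒪 overlap)

/-- Restriction of functions from `V` to the overlap. -/
def resV : (Scheme.Modules.pushforward ιV).obj (𝒪 chart) ⟶
    (Scheme.Modules.pushforward (overlapToU ≫ ιU)).obj (𝒪 overlap) :=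
  (Scheme.Modules.pushforward ιV).map (structureMap overlapToV) ≫
    (Scheme.Modules.pushforwardComp overlapToV ιV).hom.app (𝒪 overlap) ≫
    (Scheme.Modules.pushforwardCongr ι_condition).hom.app (𝒪 overlap)

/-- Multiplication by the global function `r` on the structure sheaf of `Spec R`. -/
def mulO {R : CommRingCat.{0}} (r : R) : 𝒪 (Spec R) ⟶ 𝒪 (Spec R) :=
  tildeSelf.inv ≫ tilde.map (ModuleCat.ofHom (LinearMap.mulLeft R r)) ≫ tildeSelf.hom

/-- The line bundle `𝒪(-3)` on `Tot 𝒪(-2)`, with transition function `z³`: a section is a pair of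
functions `a` on `U` and `b` on `V` such that `z³ a = b` on the overlap. -/
def L : Z₂.Modules :=
  pullback (resU ≫ (Scheme.Modules.pushforward (overlapToU ≫ ιU)).map
    (mulO ((zUnit : Pz) ^ 3))) resV

/-- The direct image of `𝒪(-3)` on the singular surface. -/
def F : X₂.Modules := (Scheme.Modules.pushforward π).obj L

/-- Coherent sheaves on a locally Noetherian scheme: the quasi-coherent sheaves of finite type. -/
def isCoherent (X : Scheme.{0}) : ObjectProperty X.Modules :=
  fun F ↦ F.IsQuasicoherent ∧ F.IsFiniteType

section Coherent

variable {R : CommRingCat.{0}}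

lemma isFiniteType_tilde (M : ModuleCat.{0} R) [h : Module.Finite R M] :
    (tilde M).IsFiniteType := by
  obtain ⟨s, hs⟩ := h.fg_top
  let p := presentationTilde M (s : Set M) hs _ (Submodule.span_eq _)
  have hp : Finite p.generators.I := inferInstanceAs (Finite (s : Set M))
  let q : (tilde M).LocalGeneratorsData := p.generators.localGeneratorsData
  have hq : ∀ i, (q.generators i).IsFiniteType := fun i ↦ ⟨hp⟩
  exact SheafOfModules.IsFiniteType.mk.{0} ⟨q, ⟨hq⟩⟩

lemma finite_of_generatingSections (F : (Spec R).Modules) (hF : F.IsQuasicoherent)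
    (G : F.GeneratingSections) (hG : G.IsFiniteType) :
    Module.Finite R ((moduleSpecΓFunctor (R := R)).obj F) := by
  let N := (moduleSpecΓFunctor (R := R)).obj F
  have hi : IsIso F.fromTildeΓ := (isQuasicoherent_iff_isIso_fromTildeΓ F).1 hF
  let e : (tilde.functor R).obj N ≅ F := @asIso _ _ _ _ F.fromTildeΓ hi
  let fr : (Spec R).Modules := SheafOfModules.free G.I
  let t : (tilde.functor R).obj (ModuleCat.of R (G.I →₀ R)) ≅ fr := tildeFinsupp G.I
  let p : fr ⟶ F := G.π
  let φ : ModuleCat.of R (G.I →₀ R) ⟶ N :=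
    (tilde.functor R).preimage (t.hom ≫ p ≫ e.inv)
  have h1 : (tilde.functor R).map φ = t.hom ≫ p ≫ e.inv :=
    Functor.map_preimage _ _
  have h2 : Epi ((tilde.functor R).map φ) := by
    rw [h1]
    have b : Epi p := G.epi
    exact @epi_comp _ _ _ _ _ _ inferInstance _ (@epi_comp _ _ _ _ _ _ b _ inferInstance)
  have : Epi φ := (tilde.functor R).epi_of_epi_map h2
  have hs := (ModuleCat.epi_iff_surjective φ).1 this
  have := hG.finite
  have : Module.Finite R (G.I →₀ R) := inferInstance
  exact Module.Finite.of_surjective φ.hom hs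

lemma isQuasicoherent_restrict {X Y : Scheme.{0}} (f : X ⟶ Y) [IsOpenImmersion f] (M : Y.Modules)
    (hM : M.IsQuasicoherent) : (M.restrict f).IsQuasicoherent :=
  @Scheme.Modules.isQuasicoherent_restrictFunctor _ _ f _ M hM

/-- Restriction of generating sections to a smaller open subscheme. -/
def restrictGenerators {X Y : Scheme.{0}} (M : X.Modules) (W : X.Opens) (f : Y ⟶ X)
    [IsOpenImmersion f] (h : f.opensRange ≤ W) (G : (M.over W).GeneratingSections) :
    (M.restrict f).GeneratingSections := by
  let u : Y ⟶ W.toScheme := IsOpenImmersion.lift W.ι f (by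
    simpa [← SetLike.coe_subset_coe] using h)
  have hu : u ≫ W.ι = f := IsOpenImmersion.lift_fac ..
  have : IsOpenImmersion u := by
    have : IsOpenImmersion (u ≫ W.ι) := by rw [hu]; infer_instance
    exact IsOpenImmersion.of_comp u W.ι
  have : PreservesColimitsOfSize.{0, 0} (Scheme.Modules.restrictFunctor u) := inferInstance
  let F := (Scheme.Modules.overEquiv W).functor ⋙ Scheme.Modules.restrictFunctor u
  let iso : SheafOfModules.overFunctor X.ringCatSheaf _ ⋙ F ≅ Scheme.Modules.restrictFunctor f :=
    (Functor.associator _ _ _).symm ≪≫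
        Functor.isoWhiskerRight (Scheme.Modules.overFunctorEquiv _) _ ≪≫
        (Scheme.Modules.restrictFunctorComp _ _).symm ≪≫ (Scheme.Modules.restrictFunctorCongr hu)
  have hF : PreservesColimitsOfSize.{0, 0} F :=
    comp_preservesColimits _ _
  let G' : SheafOfModules.GeneratingSections (F.obj (M.over W)) :=
    @SheafOfModules.GeneratingSections.map _ _ _ _ _ _ _ _ _ _ _ _ _ G F hF
      (Scheme.Modules.restrictUnitIso _).symm
  exact @SheafOfModules.GeneratingSections.ofEpi _ _ _ _ _ _ _ _ G' (iso.app M).hom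
    (show Epi (iso.app M).hom from inferInstance)

instance isOpenImmersion_away (a : R) : IsOpenImmersion
    (Spec.map (CommRingCat.ofHom (algebraMap R (Localization.Away a)))) :=
  IsOpenImmersion.of_isLocalization a

lemma exists_finset_of_finite_localization {R S M Q N : Type*} [CommRing R] [CommRing S] (a : R)
    [Algebra R S] [IsLocalization.Away a S]
    [AddCommGroup M] [Module R M] [AddCommGroup Q] [Module R Q] (ρ : M →ₗ[R] Q)
    [IsLocalizedModule (.powers a) ρ] [AddCommGroup N] [Module S N]
    [hN : Module.Finite S N] (e : N ≃+ Q)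
    (he : ∀ (r : R) (n : N), e (algebraMap R S r • n) = r • e n) :
    ∃ s : Finset M, ∀ m : M, ∃ k : ℕ, a ^ k • m ∈ Submodule.span R (s : Set M) := by
  let _ : Module R N := Module.compHom N (algebraMap R S)
  have : IsScalarTower R S N := .of_algebraMap_smul fun _ _ ↦ rfl
  let e' : Q ≃ₗ[R] N := ({ e with map_smul' := he } : N ≃ₗ[R] Q).symm
  have hf : IsLocalizedModule (.powers a) (e'.toLinearMap ∘ₗ ρ) :=
    IsLocalizedModule.of_linearEquiv _ _ _
  obtain ⟨s, hs⟩ := hN.fg_top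
  classical
  refine ⟨IsLocalizedModule.finsetIntegerMultiple (.powers a) (e'.toLinearMap ∘ₗ ρ) s, fun m ↦ ?_⟩
  obtain ⟨⟨_, n₁, rfl⟩, hn₁⟩ := multiple_mem_span_of_mem_localization_span (.powers a)
    S (s : Set N)
    (IsLocalizedModule.mk' (e'.toLinearMap ∘ₗ ρ) m (1 : Submonoid.powers a)) (by rw [hs]; trivial)
  rw [Submonoid.smul_def, ← IsLocalizedModule.mk'_smul, IsLocalizedModule.mk'_one] at hn₁
  obtain ⟨⟨_, n₂, rfl⟩, hn₂⟩ := IsLocalizedModule.smul_mem_finsetIntegerMultiple_span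
    (.powers a) (e'.toLinearMap ∘ₗ ρ) _ s hn₁
  rw [Submonoid.smul_def] at hn₂
  refine ⟨n₂ + n₁, ?_⟩
  rw [pow_add, mul_smul]
  exact hn₂

/-- The localization `R_a`. -/
def awayRing (R : CommRingCat.{0}) (a : R) : CommRingCat.{0} := .of (Localization.Away a)

/-- The localization map `R ⟶ R_a`. -/
def awayMap (R : CommRingCat.{0}) (a : R) : R ⟶ awayRing R a :=
  CommRingCat.ofHom (algebraMap R (Localization.Away a))

instance (a : R) : Algebra R (awayRing R a) := inferInstanceAs (Algebra R (Localization.Away a))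
instance (a : R) : IsLocalization.Away a (awayRing R a) :=
  inferInstanceAs (IsLocalization.Away a (Localization.Away a))

instance (a : R) : IsOpenImmersion (Spec.map (awayMap R a)) :=
  isOpenImmersion_away a

/-- The basic open subset of `Spec R` where `a` does not vanish. -/
def dopen (a : R) : (Spec R).Opens := PrimeSpectrum.basicOpen a

lemma image_awayMap (a : R) : Spec.map (awayMap R a) ''ᵁ ⊤ = dopen a := by
  refine TopologicalSpace.Opens.ext ?_
  simp only [awayMap, Scheme.Hom.image_top_eq_opensRange, Scheme.Hom.coe_opensRange]
  exact PrimeSpectrum.localization_away_comap_range (Localization.Away a) a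

/-- The global sections of a sheaf of modules on `Spec R`. -/
abbrev secTop (F : (Spec R).Modules) : Type := Γ(F, (⊤ : (Spec R).Opens))

/-- The sections of a sheaf of modules over the locus where `a` does not vanish. -/
abbrev secD (F : (Spec R).Modules) (a : R) : Type := Γ(F, dopen a)

/-- Global sections of the restriction to `Spec R_a` are sections over the basic open subset. -/
def sectionsAway (F : (Spec R).Modules) (a : R) :
    secTop (F.restrict (Spec.map (awayMap R a))) ≃+ secD F a :=
  ((F.restrictAppIso (Spec.map (awayMap R a)) ⊤) ≪≫
      F.presheaf.mapIso (eqToIso (image_awayMap a).symm).op).addCommGroupIsoToAddEquiv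

lemma sectionsAway_smul (F : (Spec R).Modules) (a r : R)
    (n : secTop (F.restrict (Spec.map (awayMap R a)))) :
    sectionsAway F a (awayMap R a r • n) = r • sectionsAway F a n := by
  have h1 := Scheme.Modules.restrictAppIso_smul_Spec (M := F) (awayMap R a) (U := ⊤) r n
  have h2 := Scheme.Modules.map_smul_Spec (M := F) (eqToHom (image_awayMap a).symm).op r
    ((F.restrictAppIso (Spec.map (awayMap R a)) ⊤).hom n)
  exact (congrArg (F.presheaf.map (eqToHom (image_awayMap a).symm).op) h1).trans h2

lemma exists_finset_of_restrict (F : (Spec R).Modules) (hF : F.IsQuasicoherent) (a : R)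
    (h : Module.Finite (awayRing R a) (secTop (F.restrict (Spec.map (awayMap R a))))) :
    ∃ s : Finset (secTop F), ∀ m, ∃ k : ℕ,
      a ^ k • m ∈ Submodule.span R (s : Set (secTop F)) := by
  have hloc := (isIso_fromTildeΓ_iff_isLocalizing F).1
    ((isQuasicoherent_iff_isIso_fromTildeΓ F).1 hF) a
  exact @exists_finset_of_finite_localization R (awayRing R a) (secTop F) (secD F a)
    (secTop (F.restrict (Spec.map (awayMap R a)))) _ _ a _ _ _ _ _ _ _ hloc _ _ h
      (sectionsAway F a) (sectionsAway_smul F a)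

lemma finite_restrict (F : (Spec R).Modules) (hF : F.IsQuasicoherent)
    (W : (Spec R).Opens) (G : (F.over W).GeneratingSections) (hG : G.IsFiniteType) (a : R)
    (h : dopen a ≤ W) :
    Module.Finite (awayRing R a) (secTop (F.restrict (Spec.map (awayMap R a)))) := by
  have h' : (Spec.map (awayMap R a)).opensRange ≤ W := by
    rw [← Scheme.Hom.image_top_eq_opensRange, image_awayMap]; exact h
  let G' := restrictGenerators F W (Spec.map (awayMap R a)) h' G
  have hG' : G'.IsFiniteType := ⟨hG.finite⟩
  exact finite_of_generatingSections _ (isQuasicoherent_restrict _ F hF) G' hG'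

lemma finite_of_isCoherent (F : (Spec R).Modules) (hF : isCoherent _ F) :
    Module.Finite R (secTop F) := by
  obtain ⟨hq, ⟨q, hq'⟩⟩ := hF
  have hq' := hq'.isFiniteType
  let t : Set R := {a | ∃ i, dopen a ≤ q.X i}
  have ht : Ideal.span t = ⊤ := by
    rw [← PrimeSpectrum.zeroLocus_empty_iff_eq_top, PrimeSpectrum.zeroLocus_span,
      Set.eq_empty_iff_forall_notMem]
    intro p hp
    have hc : IsOpenCover q.X := (Opens.coversTop_iff _ _).1 q.coversTop
    obtain ⟨i, hi⟩ := hc.exists_mem p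
    obtain ⟨_, ⟨_, ⟨r, rfl⟩, rfl⟩, hxr, hrU⟩ :=
      PrimeSpectrum.isBasis_basic_opens.exists_subset_of_mem_open hi (q.X i).2
    exact hxr (hp ⟨i, hrU⟩)
  obtain ⟨t', ht', h1⟩ := (Ideal.span_eq_top_iff_finite t).1 ht
  have key : ∀ a : t', ∃ s : Finset (secTop F), ∀ m, ∃ k : ℕ,
      (a : R) ^ k • m ∈ Submodule.span R (s : Set (secTop F)) := by
    rintro ⟨a, ha⟩
    obtain ⟨i, hi⟩ := ht' ha
    exact exists_finset_of_restrict F hq a (finite_restrict F hq _ (q.generators i) (hq' i) a hi)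
  choose s hs using key
  classical
  refine ⟨⟨Finset.univ.biUnion s, ?_⟩⟩
  rw [eq_top_iff]
  rintro m -
  refine Submodule.mem_of_span_eq_top_of_smul_pow_mem _ (t' : Set R) h1 m ?_
  intro a
  obtain ⟨k, hk⟩ := hs a m
  exact ⟨k, Submodule.span_mono (by
    intro z hz; exact Finset.mem_biUnion.2 ⟨a, Finset.mem_univ _, hz⟩) hk⟩
/-- The category of coherent sheaves on `Spec R`. -/
abbrev Coh (R : CommRingCat.{0}) : Type 1 := (isCoherent (Spec R)).FullSubcategory

lemma isCoherent_tilde (M : ModuleCat.{0} R) [Module.Finite R M] : isCoherent (Spec R) (tilde M) :=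
  ⟨show (tilde M).IsQuasicoherent from inferInstance, isFiniteType_tilde M⟩

/-- The functor sending a finitely generated module to the associated coherent sheaf. -/
def tildeFG (R : CommRingCat.{0}) : FGModuleCat.{0} R ⥤ Coh R :=
  ObjectProperty.lift _ ((ModuleCat.isFG.{0} R).ι ⋙ tilde.functor R) fun M ↦
    @isCoherent_tilde R M.obj M.property

instance : (tildeFG R).Full where
  map_surjective {M N} f := by
    obtain ⟨g, hg⟩ := (tilde.functor R).map_surjective (X := M.obj) (Y := N.obj) f.hom
    exact ⟨ObjectProperty.homMk g, ObjectProperty.hom_ext _ hg⟩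

instance : (tildeFG R).Faithful where
  map_injective h :=
    ObjectProperty.hom_ext _ ((tilde.functor R).map_injective
      (congrArg (fun k ↦ k.hom) h))

instance : (tildeFG R).EssSurj where
  mem_essImage F := by
    have h : IsIso F.obj.fromTildeΓ := (isQuasicoherent_iff_isIso_fromTildeΓ F.obj).1 F.property.1
    let N : FGModuleCat R := ⟨(moduleSpecΓFunctor (R := R)).obj F.obj,
      finite_of_isCoherent F.obj F.property⟩
    exact ⟨N, ⟨(isCoherent (Spec R)).isoMk (@asIso _ _ _ _ F.obj.fromTildeΓ h)⟩⟩

instance : (tildeFG R).IsEquivalence where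

instance [IsNoetherianRing R] : HasFiniteProducts (Coh R) :=
  ⟨fun _ ↦ Adjunction.hasLimitsOfShape_of_equivalence (tildeFG R).inv⟩

instance [IsNoetherianRing R] : Abelian (Coh R) :=
  abelianOfEquivalence (tildeFG R).inv

lemma exists_isZero_isLocallyFree (R : CommRingCat.{0}) :
    ∃ G : Coh R, IsZero G ∧ SheafOfModules.IsLocallyFree G.obj := by
  let Z : (Spec R).Modules := SheafOfModules.free PEmpty.{1}
  let g : Z.GeneratingSections := SheafOfModules.free.generatingSections PEmpty.{1}
  let q : Z.LocalGeneratorsData := g.localGeneratorsData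
  have hq : ∀ i, (q.generators i).IsFiniteType := fun i ↦ ⟨inferInstanceAs (Finite PEmpty.{1})⟩
  have h1 : Z.IsLocallyFree :=
    inferInstanceAs (SheafOfModules.free (R := (Spec R).ringCatSheaf) PEmpty.{1}).IsLocallyFree
  have h2 : Z.IsFiniteType := SheafOfModules.IsFiniteType.mk.{0} ⟨q, ⟨hq⟩⟩
  have h3 : Z.IsQuasicoherent := inferInstance
  refine ⟨⟨Z, h3, h2⟩, (IsZero.iff_id_eq_zero _).2 (ObjectProperty.hom_ext _ ?_), h1⟩
  exact (SheafOfModules.freeHomEquiv Z).injective (funext fun i ↦ i.elim)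

section Derived

variable (R) [IsNoetherianRing R]

instance : HasDerivedCategory (Coh R) := HasDerivedCategory.standard (Coh R)

/-- The bounded derived category of coherent sheaves on `Spec R`. -/
abbrev Db : Type 1 := DerivedCategory.Bounded (Coh R)

/-- A bounded complex of coherent sheaves is perfect if it is isomorphic in the derived category to
a bounded complex of locally free sheaves of finite rank. -/
def isPerfect : ObjectProperty (Db R) := fun K ↦
  ∃ P : CochainComplex (Coh R) ℤ,
    (∃ a b : ℤ, P.IsStrictlyGE a ∧ P.IsStrictlyLE b) ∧
    (∀ n, SheafOfModules.IsLocallyFree (P.X n).obj) ∧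
    Nonempty (K.obj ≅ DerivedCategory.Q.obj P)

variable {R} in
/-- A coherent sheaf, as a complex concentrated in degree zero. -/
def inDb (G : Coh R) : Db R :=
  ⟨(DerivedCategory.singleFunctor (Coh R) 0).obj G, ⟨⟨0, inferInstance⟩, ⟨0, inferInstance⟩⟩⟩

instance : (isPerfect R).Nonempty := by
  obtain ⟨G, hG, hG'⟩ := exists_isZero_isLocallyFree R
  let P : CochainComplex (Coh R) ℤ := { X := fun _ ↦ G, d := fun _ _ ↦ 0 }
  have hP : IsZero P := (IsZero.iff_id_eq_zero _).2
    (HomologicalComplex.hom_ext _ _ fun _ ↦ hG.eq_of_src _ _)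
  have h1 : P.IsStrictlyGE 0 := (CochainComplex.isStrictlyGE_iff _ _).2 fun _ _ ↦ hG
  have h2 : P.IsStrictlyLE 0 := (CochainComplex.isStrictlyLE_iff _ _).2 fun _ _ ↦ hG
  exact ⟨⟨inDb G, P, ⟨0, 0, h1, h2⟩, fun _ ↦ hG', ⟨IsZero.iso
    ((DerivedCategory.singleFunctor (Coh R) 0).map_isZero hG) (DerivedCategory.Q.map_isZero hP)⟩⟩⟩

/-- The singularity category of `Spec R`: the Verdier quotient of the bounded derived category of
coherent sheaves by the thick subcategory of perfect complexes. -/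
abbrev DSg : Type 1 := (isPerfect R).triangEnvelope.trW.Localization

variable {R} in
/-- The image of a coherent sheaf in the singularity category. -/
def inDSg (G : Coh R) : DSg R := (isPerfect R).triangEnvelope.trW.Q.obj (inDb G)

end Derived

end Coherent

/-- An object of a triangulated category generates it if every strictly full triangulated
subcategory that contains the object is the whole category. -/
def Generates {C : Type*} [Category C] [HasZeroObject C] [HasShift C ℤ] [Preadditive C]
    [∀ n : ℤ, (shiftFunctor C n).Additive] [Pretriangulated C] (X : C) : Prop :=
  ∀ T : ObjectProperty C, T.IsTriangulated → T.IsClosedUnderIsomorphisms → T X → T = ⊤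

/-- The free sheaf of rank two on `X₂`. -/
def O₂ : X₂.Modules := tilde (ModuleCat.of (CommRingCat.of A) (Fin 2 → A))

/-- The endomorphism of the free sheaf of rank two given by the matrix with rows `(y, w)` and
`(-x, -y)`. -/
def φ : O₂ ⟶ O₂ :=
  tilde.map (ModuleCat.ofHom (R := CommRingCat.of A) (Matrix.mulVecLin !![y, w; -x, -y]))

/-- The rank of a sheaf on `X₂`: the rank of its global sections over the domain `A`. -/
def rank (G : X₂.Modules) : Cardinal.{0} :=
  Module.rank A ((moduleSpecΓFunctor (R := CommRingCat.of A)).obj G)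

end

end A1Singularity

/-! ### Exactness of `tilde` and quasi-coherence of `F`. -/

namespace A1Singularity

noncomputable section

variable {R : CommRingCat.{0}}

lemma tilde_map_app_injective {M N : ModuleCat.{0} R} (f : M ⟶ N) (hf : Function.Injective f)
    (U : (Spec R).Opens) : Function.Injective ((tilde.map f).app U) := by
  intro a b h
  have h' := congrArg Subtype.val h
  refine Subtype.ext (funext fun y ↦ ?_)
  have h2 := congrFun h' y
  -- Sections of `tilde` are families of germs in localized modules, and localization preserves
  -- injectivity.
  exact LocalizedModule.map_injective _ f.hom hf h2

instance : (tilde.functor R).PreservesMonomorphisms where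
  preserves {M N} f hf := by
    have : ∀ U, Mono (((Scheme.Modules.toPresheaf _).map ((tilde.functor R).map f)).app U) := by
      intro U
      rw [AddCommGrpCat.mono_iff_injective]
      exact tilde_map_app_injective f ((ModuleCat.mono_iff_injective f).1 hf) U.unop
    have := NatTrans.mono_of_mono_app ((Scheme.Modules.toPresheaf _).map ((tilde.functor R).map f))
    exact (Scheme.Modules.toPresheaf _).mono_of_mono_map this

lemma tilde_preserves_exact (S : ShortComplex (ModuleCat.{0} R)) (hS : S.ShortExact) :
    (S.map (tilde.functor R)).ShortExact := by
  have hc : PreservesFiniteColimits (tilde.functor R) := inferInstance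
  have h := ((tilde.functor R).preservesFiniteColimits_iff_forall_exact_map_and_epi).1 hc S hS
  have := hS.mono_f
  exact { exact := h.1, mono_f := inferInstanceAs (Mono ((tilde.functor R).map S.f)), epi_g := h.2 }

instance : (tilde.functor R).PreservesHomology :=
  ((tilde.functor R).exact_tfae.out 0 2).1 tilde_preserves_exact

instance : PreservesFiniteLimits (tilde.functor R) :=
  (tilde.functor R).preservesFiniteLimits_of_preservesHomology

lemma isQuasicoherent_of_iso {X : Scheme.{0}} {M N : X.Modules} (e : M ≅ N)
    (hM : M.IsQuasicoherent) : N.IsQuasicoherent :=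
  (SheafOfModules.isQuasicoherent X.ringCatSheaf).prop_of_iso e hM

/-- Fullness lifts the cospan to `C`, where its pullback is formed and then preserved by `G`. -/
lemma essImage_pullback {C D : Type*} [Category C] [Category D] (G : C ⥤ D) [G.Full]
    [HasPullbacks C] [HasPullbacks D] [PreservesLimitsOfShape WalkingCospan G]
    {M M' N : D} (f : M ⟶ N) (g : M' ⟶ N)
    (hM : G.essImage M) (hM' : G.essImage M') (hN : G.essImage N) :
    G.essImage (pullback f g) := by
  obtain ⟨K, ⟨e⟩⟩ := hM
  obtain ⟨K', ⟨e'⟩⟩ := hM'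
  obtain ⟨L, ⟨i⟩⟩ := hN
  obtain ⟨f', hf'⟩ := G.map_surjective (e.hom ≫ f ≫ i.inv)
  obtain ⟨g', hg'⟩ := G.map_surjective (e'.hom ≫ g ≫ i.inv)
  exact ⟨pullback f' g', ⟨PreservesPullback.iso G f' g' ≪≫
    asIso (pullback.map (G.map f') (G.map g') f g e.hom e'.hom i.hom
      (by simp [hf']) (by simp [hg']))⟩⟩

lemma isQuasicoherent_pullback {M M' N : (Spec R).Modules} (f : M ⟶ N) (g : M' ⟶ N)
    (hM : M.IsQuasicoherent) (hM' : M'.IsQuasicoherent) (hN : N.IsQuasicoherent) :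
    (pullback f g).IsQuasicoherent := by
  have key (M : (Spec R).Modules) (h : M.IsQuasicoherent) : (tilde.functor R).essImage M :=
    isIso_fromTildeΓ_iff.1 ((isQuasicoherent_iff_isIso_fromTildeΓ M).1 h)
  exact (isQuasicoherent_iff_isIso_fromTildeΓ _).2 (isIso_fromTildeΓ_iff.2
    (essImage_pullback (tilde.functor R) f g (key _ hM) (key _ hM') (key _ hN)))

lemma ιU_π : ιU ≫ π = Spec.map (CommRingCat.ofHom (contractU : A →+* P)) :=
  pushout.inl_desc _ _ _

lemma ιV_π : ιV ≫ π = Spec.map (CommRingCat.ofHom (contractV : A →+* P)) :=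
  pushout.inr_desc _ _ _

lemma isQuasicoherent_pushforward {R S : CommRingCat.{0}} (f : R ⟶ S) (M : (Spec S).Modules)
    (hM : M.IsQuasicoherent) :
    ((Scheme.Modules.pushforward (Spec.map f)).obj M).IsQuasicoherent := by
  have := (isQuasicoherent_iff_isIso_fromTildeΓ M).1 hM
  exact (isQuasicoherent_iff_isIso_fromTildeΓ _).2 (isIso_fromTildeΓ_pushforward f M)

lemma isQuasicoherent_structureSheaf (R : CommRingCat.{0}) : (𝒪 (Spec R)).IsQuasicoherent :=
  (isQuasicoherent_iff_isIso_fromTildeΓ _).2 inferInstance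

lemma isQuasicoherent_pushforward_pushforward {X : Scheme.{0}} {R S : CommRingCat.{0}}
    (i : Spec S ⟶ X) (p : X ⟶ Spec R) (f : R ⟶ S) (h : i ≫ p = Spec.map f) :
    ((Scheme.Modules.pushforward p).obj
      ((Scheme.Modules.pushforward i).obj (𝒪 (Spec S)))).IsQuasicoherent :=
  isQuasicoherent_of_iso ((Scheme.Modules.pushforwardCongr h).symm.app _ ≪≫
      (Scheme.Modules.pushforwardComp i p).symm.app _)
    (isQuasicoherent_pushforward f _ (isQuasicoherent_structureSheaf S))

/-- Direct image commutes with the pullback defining `L`. Each corner becomes the direct image of a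
structure sheaf along a morphism of affine schemes, and quasi-coherent sheaves on `X₂` are closed
under pullbacks because `tilde` is exact. -/
lemma isQuasicoherent_F : F.IsQuasicoherent :=
  isQuasicoherent_of_iso (PreservesPullback.iso (Scheme.Modules.pushforward π) _ _).symm
    (isQuasicoherent_pullback _ _
      (isQuasicoherent_pushforward_pushforward ιU π _ ιU_π)
      (isQuasicoherent_pushforward_pushforward ιV π _ ιV_π)
      (isQuasicoherent_pushforward_pushforward (overlapToU ≫ ιU) π
        (CommRingCat.ofHom (contractU : A →+* P) ≫ CommRingCat.ofHom (algebraMap P Pz)) (by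
          rw [Category.assoc, ιU_π, Spec.map_comp, overlapToU])))

lemma mulO_app_top {R : CommRingCat.{0}} (r m : R) :
    (mulO r).app ⊤ ((Scheme.ΓSpecIso R).inv m) = (Scheme.ΓSpecIso R).inv (r * m) := by
  have := congr($(tilde.toOpen_map_app (ModuleCat.ofHom (LinearMap.mulLeft R r)) ⊤).hom m)
  exact this

lemma resV_app_top (a : Γ(chart, ⊤)) : resV.app ⊤ a = overlapToV.appTop a := by
  -- On global sections the comparison isomorphisms between direct images amount to restriction
  -- along an identity.
  change overlap.presheaf.map (𝟙 _) _ = _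
  rw [CategoryTheory.Functor.map_id]
  rfl

end

end A1Singularity

/-! ### Global sections of `F` as glued pairs of polynomials. -/

namespace A1Singularity

noncomputable section

/-- Restriction of sections of `𝒪(-3)` to the chart `U`. -/
def toU : L ⟶ (Scheme.Modules.pushforward ιU).obj (𝒪 chart) := pullback.fst _ _

/-- Restriction of sections of `𝒪(-3)` to the chart `V`. -/
def toV : L ⟶ (Scheme.Modules.pushforward ιV).obj (𝒪 chart) := pullback.snd _ _

lemma isPullback_L : IsPullback toU toV (resU ≫ (Scheme.Modules.pushforward (overlapToU ≫ ιU)).map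
    (mulO ((zUnit : Pz) ^ 3))) resV :=
  IsPullback.of_hasPullback _ _

/-- The functor of global sections of sheaves of modules, as a functor to types. -/
def globalSections (X : Scheme.{0}) : X.Modules ⥤ Type :=
  Scheme.Modules.toPresheaf X ⋙ (evaluation _ _).obj (.op ⊤) ⋙ forget Ab

instance (X : Scheme.{0}) : PreservesLimits (globalSections X) := by
  have : PreservesLimits ((evaluation X.Opensᵒᵖ Ab).obj (.op ⊤) ⋙ forget Ab) :=
    comp_preservesLimits _ _
  exact comp_preservesLimits _ _

lemma isPullback_sections : IsPullback ((globalSections Z₂).map toU) ((globalSections Z₂).map toV)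
    ((globalSections Z₂).map (resU ≫ (Scheme.Modules.pushforward (overlapToU ≫ ιU)).map
      (mulO ((zUnit : Pz) ^ 3)))) ((globalSections Z₂).map resV) :=
  isPullback_L.map _

/-- The module of global sections of `F`. -/
abbrev ΓF : ModuleCat A := (moduleSpecΓFunctor (R := CommRingCat.of A)).obj F

/-- The function on the chart `U` given by a global section of `F`. -/
def sectionU (s : ΓF) : P := (Scheme.ΓSpecIso (.of P)).hom (toU.app ⊤ s)

/-- The function on the chart `V` given by a global section of `F`. -/
def sectionV (s : ΓF) : P := (Scheme.ΓSpecIso (.of P)).hom (toV.app ⊤ s)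

lemma sectionU_add (s t : ΓF) : sectionU (s + t) = sectionU s + sectionU t :=
  (congrArg _ (map_add (toU.app ⊤).hom s t)).trans
    (map_add (Scheme.ΓSpecIso (.of P)).hom.hom _ _)

lemma appTop_contractU (a : A) : (Scheme.ΓSpecIso (.of P)).hom
    (ιU.appTop (π.appTop ((Scheme.ΓSpecIso (.of A)).inv a))) = contractU a := by
  have h : (Scheme.ΓSpecIso (.of A)).inv ≫ (ιU ≫ π).appTop ≫ (Scheme.ΓSpecIso (.of P)).hom =
      CommRingCat.ofHom (contractU : A →+* P) := by
    rw [ιU_π, Scheme.ΓSpecIso_naturality, Iso.inv_hom_id_assoc]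
  exact congr($h a)

lemma sectionU_smul (a : A) (s : ΓF) :
    sectionU (a • s) = contractU a * sectionU s := by
  have h1 : toU.app ⊤ (a • s) =
      (ιU.appTop (π.appTop (X₂.presheaf.map (𝟙 _) ((Scheme.ΓSpecIso (.of A)).inv a))) :
        Γ(chart, ⊤)) * (show Γ(chart, ⊤) from toU.app ⊤ s) :=
    Scheme.Modules.Hom.app_smul toU (U := ⊤)
      (π.appTop (X₂.presheaf.map (𝟙 _) ((Scheme.ΓSpecIso (.of A)).inv a))) s
  rw [CategoryTheory.Functor.map_id] at h1
  unfold sectionU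
  rw [h1, ← appTop_contractU]
  exact map_mul (Scheme.ΓSpecIso (.of P)).hom.hom _ _

lemma appTop_overlapToU (p : P) : overlapToU.appTop ((Scheme.ΓSpecIso (.of P)).inv p) =
    (Scheme.ΓSpecIso (.of Pz)).inv (algebraMap P Pz p) := by
  have h := Scheme.ΓSpecIso_inv_naturality (CommRingCat.ofHom (algebraMap P Pz))
  exact congr($h p).symm

lemma appTop_overlapToV (p : P) : overlapToV.appTop ((Scheme.ΓSpecIso (.of P)).inv p) =
    (Scheme.ΓSpecIso (.of Pz)).inv (transPoly p) := by
  have h := Scheme.ΓSpecIso_inv_naturality (CommRingCat.ofHom (algebraMap P Pz) ≫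
    CommRingCat.ofHom (transEquiv : Pz →+* Pz))
  rw [Spec.map_comp] at h
  rw [← transAux_algebraMap]
  exact congr($h p).symm

lemma gluing_app_top (a : P) : (resU ≫ (Scheme.Modules.pushforward (overlapToU ≫ ιU)).map
      (mulO ((zUnit : Pz) ^ 3))).app ⊤ ((Scheme.ΓSpecIso (.of P)).inv a) =
      (Scheme.ΓSpecIso (.of Pz)).inv ((zUnit : Pz) ^ 3 * algebraMap P Pz a) := by
  rw [← mulO_app_top (R := .of Pz), ← appTop_overlapToU]
  rfl

lemma gluing_app_top' (b : P) : resV.app ⊤ ((Scheme.ΓSpecIso (.of P)).inv b) =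
      (Scheme.ΓSpecIso (.of Pz)).inv (transPoly b) := by
  rw [← appTop_overlapToV]
  exact resV_app_top _

lemma ΓSpecIso_inv_injective (R : CommRingCat.{0}) :
    Function.Injective (Scheme.ΓSpecIso R).inv :=
  Function.LeftInverse.injective (g := (Scheme.ΓSpecIso R).hom) fun a ↦ by simp

lemma ΓSpecIso_hom_injective (R : CommRingCat.{0}) :
    Function.Injective (Scheme.ΓSpecIso R).hom :=
  Function.LeftInverse.injective (g := (Scheme.ΓSpecIso R).inv) fun a ↦ by simp

lemma gluing_sections (s : ΓF) :
    (zUnit : Pz) ^ 3 * algebraMap P Pz (sectionU s) = transPoly (sectionV s) := by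
  apply ΓSpecIso_inv_injective (.of Pz)
  have h1 := gluing_app_top (sectionU s)
  have h2 := gluing_app_top' (sectionV s)
  unfold sectionU at h1
  unfold sectionV at h2
  erw [Iso.hom_inv_id_apply] at h1 h2
  exact h1.symm.trans ((congr($(isPullback_sections.w) s)).trans h2)

lemma exists_section (a b : P) (h : (zUnit : Pz) ^ 3 * algebraMap P Pz a = transPoly b) :
    ∃ s : ΓF, sectionU s = a := by
  obtain ⟨s, hs, -⟩ := Types.exists_of_isPullback isPullback_sections
    ((Scheme.ΓSpecIso (.of P)).inv a) ((Scheme.ΓSpecIso (.of P)).inv b)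
    ((gluing_app_top a).trans ((congrArg _ h).trans (gluing_app_top' b).symm))
  refine ⟨s, ?_⟩
  refine (congrArg (Scheme.ΓSpecIso (.of P)).hom hs).trans ?_
  exact Iso.inv_hom_id_apply (Scheme.ΓSpecIso (.of P)) a

/-- The function on `V` is recovered from the one on `U` by the gluing condition. -/
lemma sectionU_injective (h : Function.Injective transPoly) : Function.Injective sectionU := by
  intro s t hst
  refine Types.ext_of_isPullback isPullback_sections (ΓSpecIso_hom_injective (.of P) hst)
    (ΓSpecIso_hom_injective (.of P) ?_)
  apply h
  exact (gluing_sections s).symm.trans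
    ((congrArg (fun p ↦ (zUnit : Pz) ^ 3 * algebraMap P Pz p) hst).trans (gluing_sections t))

end

end A1Singularity

/-! ### The ring `A` as the ring of even polynomials in two variables. -/

namespace A1Singularity

noncomputable section

open MvPolynomial

lemma monomial_fin_two (e : Fin 2 →₀ ℕ) (c : ℂ) :
    (monomial e c : P) = c • (X 0 ^ e 0 * X 1 ^ e 1) := by
  rw [monomial_eq, Finsupp.prod_fintype _ _ (by simp), Fin.prod_univ_two, smul_eq_C_mul]

@[elab_as_elim]
lemma induction_plane {motive : P → Prop} (p : P)
    (smul : ∀ (c : ℂ) i j, motive (c • (X 0 ^ i * X 1 ^ j)))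
    (add : ∀ p q, motive p → motive q → motive (p + q)) : motive p := by
  induction p using MvPolynomial.induction_on' with
  | monomial e c => rw [monomial_fin_two]; exact smul _ _ _
  | add p q hp hq => exact add p q hp hq

/-- The linear map on polynomials in two variables with prescribed values on monomials. -/
def ofMonomials {M : Type*} [AddCommGroup M] [Module ℂ M] (f : ℕ → ℕ → M) : P →ₗ[ℂ] M :=
  (basisMonomials (Fin 2) ℂ).constr ℂ fun e ↦ f (e 0) (e 1)

lemma ofMonomials_apply {M : Type*} [AddCommGroup M] [Module ℂ M] (f : ℕ → ℕ → M) (i j : ℕ) :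
    ofMonomials f (X 0 ^ i * X 1 ^ j) = f i j := by
  have h : (X 0 ^ i * X 1 ^ j : P) =
      basisMonomials (Fin 2) ℂ (Finsupp.single 0 i + Finsupp.single 1 j) := by
    simp [coe_basisMonomials, monomial_fin_two]
  rw [h, ofMonomials, Module.Basis.constr_basis]
  simp

lemma y_sq : y ^ 2 = x * w := by
  rw [← sub_eq_zero]
  exact Ideal.Quotient.eq_zero_iff_mem.2 (Ideal.subset_span rfl)

@[elab_as_elim]
lemma induction_A {motive : A → Prop} (a : A)
    (smul : ∀ (c : ℂ) i j k, motive (c • (x ^ i * y ^ j * w ^ k)))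
    (add : ∀ p q, motive p → motive q → motive (p + q)) : motive a := by
  obtain ⟨p, rfl⟩ := Ideal.Quotient.mk_surjective a
  have key (e : Fin 3 →₀ ℕ) (c : ℂ) : motive (Ideal.Quotient.mk relIdeal (monomial e c)) := by
    have : Ideal.Quotient.mk relIdeal (monomial e c) = c • (x ^ e 0 * y ^ e 1 * w ^ e 2) := by
      rw [monomial_eq, Finsupp.prod_fintype _ _ (by simp), Fin.prod_univ_three, ← smul_eq_C_mul]
      rfl
    rw [this]
    exact smul _ _ _ _
  induction p using MvPolynomial.induction_on' with
  | monomial e c => exact key e c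
  | add p q hp hq => rw [map_add]; exact add _ _ hp hq

/-- A linear retraction of the contraction on `U`. -/
def retractU : P →ₗ[ℂ] A :=
  ofMonomials fun i j ↦ x ^ (j - (i + 1) / 2) * y ^ (i % 2) * w ^ (i / 2)

/-- The relation `y² = xw` brings monomials to the form `x^a y^ε w^b` with `ε ≤ 1`, and such a form
is determined by its image `z^i u^j`: `ε` is the parity of `i`. The truncated subtraction in
`retractU` matters only off the image, where `i > 2j`. -/
lemma retractU_contractU (a : A) : retractU (contractU a) = a := by
  induction a using induction_A with
  | add p q hp hq => rw [map_add, map_add, hp, hq]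
  | smul c i j k =>
    rw [map_smul, map_smul]
    congr 1
    have : contractU (x ^ i * y ^ j * w ^ k) = X 0 ^ (j + 2 * k) * X 1 ^ (i + j + k) := by
      simp only [map_mul, map_pow, contractU_x, contractU_y, contractU_w]
      ring
    rw [this, retractU, ofMonomials_apply]
    have h1 : i + j + k - (j + 2 * k + 1) / 2 = i + j / 2 := by omega
    have h2 : (j + 2 * k) % 2 = j % 2 := by omega
    have h3 : (j + 2 * k) / 2 = j / 2 + k := by omega
    rw [h1, h2, h3]
    conv_rhs => rw [← Nat.div_add_mod j 2, pow_add, pow_mul, y_sq]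
    ring

lemma contractU_injective : Function.Injective contractU :=
  Function.LeftInverse.injective retractU_contractU

/-- The embedding of `A` as the ring of even polynomials in two variables `s`, `t`:
`x ↦ s²`, `y ↦ s t`, `w ↦ t²`. -/
def even : A →ₐ[ℂ] P :=
  Ideal.Quotient.liftₐ relIdeal
    (MvPolynomial.aeval ![X 0 ^ 2, X 0 * X 1, X 1 ^ 2]) (by
    intro a ha
    rw [← RingHom.mem_ker]
    revert a
    rw [← SetLike.le_def, Ideal.span_singleton_le_iff_mem, RingHom.mem_ker]
    simp
    ring_nf)

lemma even_x : even x = X 0 ^ 2 := by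
  exact MvPolynomial.aeval_X (R := ℂ) _ (0 : Fin 3)

lemma even_y : even y = X 0 * X 1 := by
  exact MvPolynomial.aeval_X (R := ℂ) _ (1 : Fin 3)

lemma even_w : even w = X 1 ^ 2 := by
  exact MvPolynomial.aeval_X (R := ℂ) _ (2 : Fin 3)

/-- The projection of polynomials in two variables onto their even part. -/
def evenPart : P →ₗ[ℂ] A :=
  ofMonomials fun i j ↦ if (i + j) % 2 = 0 then x ^ (i / 2) * y ^ (i % 2) * w ^ (j / 2) else 0

lemma evenPart_monomial (i j : ℕ) : evenPart (X 0 ^ i * X 1 ^ j) =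
    if (i + j) % 2 = 0 then x ^ (i / 2) * y ^ (i % 2) * w ^ (j / 2) else 0 :=
  ofMonomials_apply _ _ _

lemma evenPart_even (a : A) : evenPart (even a) = a := by
  induction a using induction_A with
  | add p q hp hq => rw [map_add, map_add, hp, hq]
  | smul c i j k =>
    rw [map_smul, map_smul]
    congr 1
    have : even (x ^ i * y ^ j * w ^ k) = X 0 ^ (2 * i + j) * X 1 ^ (j + 2 * k) := by
      simp only [map_mul, map_pow, even_x, even_y, even_w]
      ring
    rw [this, evenPart_monomial, if_pos (by omega)]
    have h1 : (2 * i + j) / 2 = i + j / 2 := by omega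
    have h2 : (2 * i + j) % 2 = j % 2 := by omega
    have h3 : (j + 2 * k) / 2 = j / 2 + k := by omega
    rw [h1, h2, h3]
    conv_rhs => rw [← Nat.div_add_mod j 2, pow_add, pow_mul, y_sq]
    ring

lemma even_injective : Function.Injective even :=
  Function.LeftInverse.injective evenPart_even

instance : IsDomain A := even_injective.isDomain even.toRingHom

/-- The involution `s ↦ -s`, `t ↦ -t`. -/
def negVars : P →ₐ[ℂ] P := aeval ![-X 0, -X 1]

lemma negVars_X0 : negVars (X 0) = -X 0 := by simp [negVars]
lemma negVars_X1 : negVars (X 1) = -X 1 := by simp [negVars]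

lemma negVars_monomial (i j : ℕ) :
    negVars (X 0 ^ i * X 1 ^ j) = (-1) ^ (i + j) * (X 0 ^ i * X 1 ^ j) := by
  rw [map_mul, map_pow, map_pow, negVars_X0, negVars_X1, neg_pow, neg_pow (X 1 : P)]
  ring

lemma negVars_negVars (f : P) : negVars (negVars f) = f := by
  induction f using induction_plane with
  | add p q hp hq => rw [map_add, map_add, hp, hq]
  | smul c i j =>
    rw [map_smul, map_smul, negVars_monomial, map_mul, negVars_monomial, ← mul_assoc, map_pow,
      map_neg, map_one, ← mul_pow]
    simp

lemma negVars_even (a : A) : negVars (even a) = even a := by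
  induction a using induction_A with
  | add p q hp hq => rw [map_add, map_add, hp, hq]
  | smul c i j k =>
    simp only [map_smul, map_mul, map_pow, even_x, even_y, even_w, negVars_X0, negVars_X1]
    ring_nf

lemma two_mul_even_evenPart (f : P) : 2 * even (evenPart f) = f + negVars f := by
  induction f using induction_plane with
  | add p q hp hq => rw [map_add, map_add, map_add, mul_add, hp, hq]; ring
  | smul c i j =>
    rw [map_smul, map_smul, map_smul, evenPart_monomial, negVars_monomial, mul_smul_comm,
      ← smul_add]
    congr 1
    split_ifs with h
    · rw [(Nat.even_iff.2 h).neg_one_pow]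
      simp only [map_mul, map_pow, even_x, even_y, even_w]
      have h1 : X 0 ^ i = (X 0 ^ (2 * (i / 2) + i % 2) : P) := by rw [Nat.div_add_mod]
      have h2 : X 1 ^ j = (X 1 ^ (2 * (j / 2) + i % 2) : P) := by congr 1; omega
      rw [h1, h2]
      ring
    · rw [(Nat.odd_iff.2 (by omega)).neg_one_pow]
      simp

lemma even_evenPart_of_negVars_eq {f : P} (h : negVars f = f) : even (evenPart f) = f := by
  have := two_mul_even_evenPart f
  rw [h, ← two_mul] at this
  exact mul_left_cancel₀ two_ne_zero this

/-- Only the odd part of `h` contributes, and it has the form `s c + t d` with `c`, `d` even.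
Multiplying by `s` and by `t` gives both formulas with the same `c` and `d`. -/
lemma exists_evenPart_mul (h : P) : ∃ c d : A,
    evenPart (X 0 * h) = x * c + y * d ∧ evenPart (X 1 * h) = y * c + w * d := by
  induction h using induction_plane with
  | add p q hp hq =>
    obtain ⟨c, d, h1, h2⟩ := hp
    obtain ⟨c', d', h1', h2'⟩ := hq
    refine ⟨c + c', d + d', ?_, ?_⟩
    · rw [mul_add, map_add, h1, h1']; ring
    · rw [mul_add, map_add, h2, h2']; ring
  | smul r i j =>
    suffices ∃ c d : A, evenPart (X 0 * (X 0 ^ i * X 1 ^ j)) = x * c + y * d ∧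
        evenPart (X 1 * (X 0 ^ i * X 1 ^ j)) = y * c + w * d by
      obtain ⟨c, d, h1, h2⟩ := this
      refine ⟨r • c, r • d, ?_, ?_⟩
      · rw [mul_smul_comm, map_smul, h1, smul_add, mul_smul_comm, mul_smul_comm]
      · rw [mul_smul_comm, map_smul, h2, smul_add, mul_smul_comm, mul_smul_comm]
    have e1 : (X 0 * (X 0 ^ i * X 1 ^ j) : P) = X 0 ^ (i + 1) * X 1 ^ j := by ring
    have e2 : (X 1 * (X 0 ^ i * X 1 ^ j) : P) = X 0 ^ i * X 1 ^ (j + 1) := by ring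
    rw [e1, e2, evenPart_monomial, evenPart_monomial]
    obtain ⟨k, rfl | rfl⟩ : ∃ k, i = 2 * k ∨ i = 2 * k + 1 := ⟨i / 2, by omega⟩
    · obtain ⟨l, rfl | rfl⟩ : ∃ l, j = 2 * l ∨ j = 2 * l + 1 := ⟨j / 2, by omega⟩
      · exact ⟨0, 0, by rw [if_neg (by omega)]; ring, by rw [if_neg (by omega)]; ring⟩
      · refine ⟨0, x ^ k * w ^ l, ?_, ?_⟩
        · rw [if_pos (by omega), show (2 * k + 1) / 2 = k by omega,
            show (2 * k + 1) % 2 = 1 by omega, show (2 * l + 1) / 2 = l by omega]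
          ring
        · rw [if_pos (by omega), show (2 * k) / 2 = k by omega,
            show (2 * k) % 2 = 0 by omega, show (2 * l + 1 + 1) / 2 = l + 1 by omega]
          ring
    · obtain ⟨l, rfl | rfl⟩ : ∃ l, j = 2 * l ∨ j = 2 * l + 1 := ⟨j / 2, by omega⟩
      · refine ⟨x ^ k * w ^ l, 0, ?_, ?_⟩
        · rw [if_pos (by omega), show (2 * k + 1 + 1) / 2 = k + 1 by omega,
            show (2 * k + 1 + 1) % 2 = 0 by omega, show (2 * l) / 2 = l by omega]
          ring
        · rw [if_pos (by omega), show (2 * k + 1) / 2 = k by omega,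
            show (2 * k + 1) % 2 = 1 by omega, show (2 * l + 1) / 2 = l by omega]
          ring
      · exact ⟨0, 0, by rw [if_neg (by omega)]; ring, by rw [if_neg (by omega)]; ring⟩

/-- The ideal `(x, y)` of `A`. -/
def ruling : Ideal A := Ideal.span {x, y}

lemma mem_ruling {a : A} : a ∈ ruling ↔ ∃ c d, x * c + y * d = a := by
  rw [ruling, Ideal.mem_span_pair]
  simp only [mul_comm x, mul_comm y]

lemma evenPart_X0_mul_mem (h : P) : evenPart (X 0 * h) ∈ ruling := by
  obtain ⟨c, d, h1, -⟩ := exists_evenPart_mul h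
  exact mem_ruling.2 ⟨c, d, h1.symm⟩

end

end A1Singularity

/-! ### Identification of the sections of `F` with the ideal `(x, y)`. -/

namespace A1Singularity

noncomputable section

open MvPolynomial

lemma algebraMap_Pz_injective : Function.Injective (algebraMap P Pz) :=
  IsLocalization.injective Pz (powers_le_nonZeroDivisors_of_noZeroDivisors (X_ne_zero 0))

lemma transPoly_injective : Function.Injective transPoly := by
  intro a b h
  rw [← transAux_algebraMap, ← transAux_algebraMap] at h
  exact algebraMap_Pz_injective (transEquiv.injective h)

/-- The monomial `ξ^k v^l` becomes `z^(2l-k) u^l`, so the exponent of `z` is at most twice that of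
`u`; the factor `z^n` clears denominators and shifts this bound by `n`. -/
lemma exists_pow_mul_transPoly (b : P) : ∃ (n : ℕ) (q : P),
    (zUnit : Pz) ^ n * transPoly b = algebraMap P Pz q ∧
      ∀ e ∈ q.support, e 0 ≤ n + 2 * e 1 := by
  induction b using induction_plane with
  | smul c k l =>
    refine ⟨k, c • (X 0 ^ (2 * l) * X 1 ^ l), ?_, ?_⟩
    · have hc (p : P) : algebraMap P Pz (c • p) = c • algebraMap P Pz p :=
        map_smul (Algebra.algHom ℂ P Pz) c p
      rw [map_smul, map_mul, map_pow, map_pow, transPoly_X0, transPoly_X1, mul_smul_comm, hc,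
        map_mul, map_pow, map_pow, algebraMap_X0, mul_pow, ← pow_mul, ← mul_assoc, ← mul_pow,
        Units.mul_inv, one_pow, one_mul]
    · intro e he
      have : (X 0 ^ (2 * l) * X 1 ^ l : P) =
          monomial (Finsupp.single 0 (2 * l) + Finsupp.single 1 l) 1 := by
        simp [monomial_fin_two]
      rw [this] at he
      have he := support_monomial_subset (support_smul he)
      rw [Finset.mem_singleton] at he
      subst he
      simp
  | add p q hp hq =>
    obtain ⟨n, f, hf, hf'⟩ := hp
    obtain ⟨m, g, hg, hg'⟩ := hq
    have key (f : P) (n m : ℕ) (h : ∀ e ∈ f.support, e 0 ≤ n + 2 * e 1) :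
        ∀ e ∈ (X 0 ^ m * f).support, e 0 ≤ n + m + 2 * e 1 := by
      intro e he
      rw [mem_support_iff, X_pow_eq_monomial, coeff_monomial_mul'] at he
      split_ifs at he with h0
      · have := h _ (mem_support_iff.2 (by simpa using he))
        simp at this
        omega
      · exact absurd rfl he
    refine ⟨n + m, X 0 ^ m * f + X 0 ^ n * g, ?_, ?_⟩
    · rw [map_add, map_add, map_mul, map_mul, ← hf, ← hg, map_pow, map_pow, algebraMap_X0]
      ring
    · intro e he
      rcases Finset.mem_union.1 (support_add he) with he | he
      · exact key f n m hf' e he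
      · rw [add_comm n]
        exact key g m n hg' e he

lemma support_of_gluing (a b : P) (h : (zUnit : Pz) ^ 3 * algebraMap P Pz a = transPoly b) :
    ∀ e ∈ a.support, e 0 + 3 ≤ 2 * e 1 := by
  obtain ⟨n, q, hq, hq'⟩ := exists_pow_mul_transPoly b
  have hq2 : q = X 0 ^ (n + 3) * a := by
    apply algebraMap_Pz_injective
    rw [← hq, ← h, map_mul, map_pow, algebraMap_X0]
    ring
  intro e he
  have h1 := hq' (e + Finsupp.single 0 (n + 3)) (by
    rw [mem_support_iff, hq2, mul_comm, X_pow_eq_monomial, coeff_mul_monomial, mul_one,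
      ← mem_support_iff]
    exact he)
  simp at h1
  omega

/-- The polynomial ring in two variables as an `A`-module by means of the contraction on `U`. -/
abbrev moduleU : Module A P := Module.compHom P (contractU : A →+* P)

section

attribute [local instance] moduleU

/-- Multiplication by `u` on the ideal `(x, y)`, with values in the functions on `U`. -/
def rulingToP : ruling →ₗ[A] P where
  toFun i := X 1 * contractU i
  map_add' i j := by simp [mul_add]
  map_smul' a i := by
    change X 1 * contractU (a * i) = contractU a * (X 1 * contractU i)
    rw [map_mul]
    ring

/-- Restriction of global sections of `F` to the chart `U`, as a linear map. -/
def sectionsToP : ΓF →ₗ[A] P where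
  toFun := sectionU
  map_add' := sectionU_add
  map_smul' := sectionU_smul

lemma rulingToP_injective : Function.Injective rulingToP := by
  intro i j h
  exact Subtype.ext (contractU_injective (mul_left_cancel₀ (X_ne_zero 1) h))

lemma algebraMap_contractU (a : A) :
    algebraMap P Pz (contractU a) = transPoly (contractV a) := by
  have h0 : ((zUnit⁻¹ : Pzˣ) : Pz) * (zUnit : Pz) = 1 := zUnit.inv_mul
  have hx : algebraMap P Pz (contractU x) = transPoly (contractV x) := by
    rw [contractU_x, contractV_x, map_mul, map_pow, transPoly_X0, transPoly_X1, ← mul_assoc,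
      ← mul_pow, h0, one_pow, one_mul]
  have hy : algebraMap P Pz (contractU y) = transPoly (contractV y) := by
    rw [contractU_y, contractV_y, map_mul, map_mul, transPoly_X0, transPoly_X1, ← mul_assoc,
      pow_two, ← mul_assoc, h0, one_mul, algebraMap_X0]
  have hw : algebraMap P Pz (contractU w) = transPoly (contractV w) := by
    rw [contractU_w, contractV_w, map_mul, map_pow, transPoly_X1, algebraMap_X0]
  induction a using induction_A with
  | add p q hp hq => simp only [map_add, hp, hq]
  | smul c i j k =>
    have hc (p : P) : algebraMap P Pz (c • p) = c • algebraMap P Pz p :=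
      map_smul (Algebra.algHom ℂ P Pz) c p
    simp only [map_smul, hc, map_mul, map_pow, hx, hy, hw]

/-- The generators correspond to the glued pairs `(u², ξv²)` and `(zu², v²)`. -/
lemma gluing_generators (c d : A) :
    (zUnit : Pz) ^ 3 * algebraMap P Pz (X 1 * contractU (x * c + y * d)) =
      transPoly (X 0 * X 1 ^ 2 * contractV c + X 1 ^ 2 * contractV d) := by
  simp only [map_add, map_mul, map_pow, contractU_x, contractU_y, algebraMap_contractU,
    transPoly_X0, transPoly_X1, algebraMap_X0]
  have h0 : (zUnit : Pz) * ((zUnit⁻¹ : Pzˣ) : Pz) = 1 := zUnit.mul_inv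
  linear_combination (-(zUnit : Pz) ^ 3 * algebraMap P Pz (X 1) ^ 2 * transPoly (contractV c)) * h0

/-- Both sides are spanned by the `z^i u^j` with `i + 3 ≤ 2j`. For `i = 2k` or `2k + 1` this means
`j = k + 2 + l`, and the monomial is `u` times `x` or `y` times `x^l w^k`. -/
lemma range_eq : LinearMap.range rulingToP = LinearMap.range sectionsToP := by
  apply le_antisymm
  · rintro _ ⟨⟨i, hi⟩, rfl⟩
    obtain ⟨c, d, rfl⟩ := mem_ruling.1 hi
    exact exists_section _ _ (gluing_generators c d)
  · rintro _ ⟨s, rfl⟩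
    have h := support_of_gluing _ _ (gluing_sections s)
    change sectionU s ∈ _
    rw [(sectionU s).as_sum]
    refine Submodule.sum_mem _ fun e he ↦ ?_
    have he := h e he
    generalize coeff e (sectionU s) = r
    rw [monomial_fin_two]
    generalize hi : e 0 = i at *
    generalize hj : e 1 = j at *
    obtain ⟨k, rfl | rfl⟩ : ∃ k, i = 2 * k ∨ i = 2 * k + 1 := ⟨i / 2, by omega⟩
    · obtain ⟨l, rfl⟩ : ∃ l, j = k + 2 + l := ⟨j - k - 2, by omega⟩
      refine ⟨⟨x * (r • (x ^ l * w ^ k)), mem_ruling.2 ⟨r • (x ^ l * w ^ k), 0, by rw [mul_zero, add_zero]⟩⟩, ?_⟩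
      change X 1 * contractU (x * (r • (x ^ l * w ^ k))) = _
      rw [map_mul, map_smul, map_mul, map_pow, map_pow, contractU_x, contractU_w, mul_smul_comm,
        mul_smul_comm]
      congr 1
      ring
    · obtain ⟨l, rfl⟩ : ∃ l, j = k + 2 + l := ⟨j - k - 2, by omega⟩
      refine ⟨⟨y * (r • (x ^ l * w ^ k)), mem_ruling.2 ⟨0, _, by rw [mul_zero, zero_add]⟩⟩, ?_⟩
      change X 1 * contractU (y * (r • (x ^ l * w ^ k))) = _
      rw [map_mul, map_smul, map_mul, map_pow, map_pow, contractU_x, contractU_y, contractU_w,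
        mul_smul_comm, mul_smul_comm]
      congr 1
      ring

/-- The module of global sections of `F` is isomorphic to the ideal `(x, y)`. -/
def rulingEquiv : ruling ≃ₗ[A] ΓF :=
  LinearEquiv.ofInjective rulingToP rulingToP_injective ≪≫ₗ LinearEquiv.ofEq _ _ range_eq ≪≫ₗ
    (LinearEquiv.ofInjective sectionsToP (sectionU_injective transPoly_injective)).symm

end

/-! ### The matrix factorization and the self-syzygy of `(x, y)`. -/

/-- The surjection from the free module of rank two onto the ideal `(x, y)`. -/
def rulingCover : (Fin 2 → A) →ₗ[A] ruling where
  toFun v := ⟨x * v 0 + y * v 1, mem_ruling.2 ⟨_, _, rfl⟩⟩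
  map_add' v v' := Subtype.ext (by simp; ring)
  map_smul' a v := Subtype.ext (by simp; ring)

/-- The matrix with rows `(y, w)` and `(-x, -y)` as an endomorphism of `A²`. -/
abbrev factorization : (Fin 2 → A) →ₗ[A] (Fin 2 → A) := Matrix.mulVecLin !![y, w; -x, -y]

lemma factorization_apply (v : Fin 2 → A) :
    factorization v = ![y * v 0 + w * v 1, -(x * v 0 + y * v 1)] := by
  ext i
  fin_cases i
  · simp [factorization, Matrix.mulVec, dotProduct]
  · simp [factorization, Matrix.mulVec, dotProduct]
    ring

lemma rulingCover_surjective : Function.Surjective rulingCover := by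
  rintro ⟨i, hi⟩
  obtain ⟨c, d, h⟩ := mem_ruling.1 hi
  exact ⟨![c, d], Subtype.ext h⟩

lemma rulingCover_eq_zero_iff (v : Fin 2 → A) : rulingCover v = 0 ↔ x * v 0 + y * v 1 = 0 :=
  Subtype.ext_iff

lemma rulingCover_factorization (v : Fin 2 → A) : rulingCover (factorization v) = 0 := by
  rw [rulingCover_eq_zero_iff, factorization_apply]
  simp only [Matrix.cons_val_zero, Matrix.cons_val_one]
  linear_combination (-v 1) * y_sq

/-- In `ℂ[s, t]` the relation reads `s v₀ = -t v₁`, so `v₁ = s f` and `v₀ = -t f` for some `f`.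
Applying `exists_evenPart_mul` to `-f` gives the preimage. -/
lemma exists_factorization_eq {v : Fin 2 → A} (hv : x * v 0 + y * v 1 = 0) :
    ∃ u, factorization u = v := by
  have h := congrArg even hv
  simp only [map_add, map_mul, even_x, even_y, map_zero] at h
  have hX0 : (X 0 : P) ≠ 0 := X_ne_zero 0
  have h1 : X 0 * even (v 0) = - (X 1 * even (v 1)) := by
    apply mul_left_cancel₀ hX0
    linear_combination h
  have hp : Prime (X 0 : P) := X_prime
  have hdvd : (X 0 : P) ∣ even (v 1) := by
    have : (X 0 : P) ∣ X 1 * even (v 1) := ⟨- even (v 0), by linear_combination h1⟩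
    refine (hp.dvd_or_dvd this).resolve_left fun h ↦ ?_
    rw [X_dvd_X] at h
    simp at h
  obtain ⟨f, hf⟩ := hdvd
  have hf' : even (v 0) = X 1 * (-f) := by
    apply mul_left_cancel₀ hX0
    rw [h1, hf]
    ring
  obtain ⟨c, d, hc, hd⟩ := exists_evenPart_mul (-f)
  refine ⟨![c, d], ?_⟩
  rw [factorization_apply]
  simp only [Matrix.cons_val_zero, Matrix.cons_val_one]
  rw [← hc, ← hd, ← hf', evenPart_even, mul_neg, ← hf, map_neg, evenPart_even, neg_neg]
  ext i
  fin_cases i <;> rfl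

lemma exact_factorization_rulingCover : Function.Exact factorization rulingCover := by
  intro v
  rw [rulingCover_eq_zero_iff]
  refine ⟨exists_factorization_eq, ?_⟩
  rintro ⟨u, rfl⟩
  exact (rulingCover_eq_zero_iff _).1 (rulingCover_factorization u)

/-- The second row of the matrix is minus the row defining `rulingCover`, which gives one direction.
Conversely, the kernel of `rulingCover` is the image of the matrix, whose square is zero. -/
lemma factorization_eq_zero_iff (v : Fin 2 → A) : factorization v = 0 ↔ rulingCover v = 0 := by
  rw [rulingCover_eq_zero_iff]
  refine ⟨fun h ↦ ?_, fun h ↦ ?_⟩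
  · rw [factorization_apply] at h
    exact neg_eq_zero.1 (congrFun h 1)
  · obtain ⟨u, rfl⟩ := exists_factorization_eq h
    rw [factorization_apply, factorization_apply]
    ext i
    fin_cases i
    · simp
      linear_combination (u 0) * y_sq
    · simp
      linear_combination (u 1) * y_sq

lemma exact_factorization : Function.Exact factorization factorization := fun v ↦
  (factorization_eq_zero_iff v).trans (exact_factorization_rulingCover v)

/-- The kernel of `A² → (x, y)` is isomorphic to `(x, y)`. -/
def rulingEquivKer : ruling ≃ₗ[A] LinearMap.ker rulingCover :=
  (rulingCover.quotKerEquivOfSurjective rulingCover_surjective).symm ≪≫ₗ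
    Submodule.quotEquivOfEq _ (LinearMap.ker factorization) (Submodule.ext fun v ↦ (factorization_eq_zero_iff v).symm) ≪≫ₗ
    factorization.quotKerEquivRange ≪≫ₗ
    LinearEquiv.ofEq _ _ (LinearMap.exact_iff.1 exact_factorization_rulingCover).symm

lemma x_ne_zero : x ≠ 0 := by
  intro h
  have := congrArg even h
  rw [even_x, map_zero] at this
  exact pow_ne_zero 2 (X_ne_zero 0) this

lemma y_ne_zero : y ≠ 0 := by
  intro h
  have := congrArg even h
  rw [even_y, map_zero] at this
  exact mul_ne_zero (X_ne_zero 0) (X_ne_zero 1) this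

lemma rank_ruling : Module.rank A ruling = 1 := by
  apply le_antisymm
  · rw [← Module.rank_self A]
    exact LinearMap.rank_le_of_injective ruling.subtype Subtype.val_injective
  · rw [← Module.rank_self A]
    refine LinearMap.rank_le_of_injective (LinearMap.toSpanSingleton A ruling
      ⟨x, mem_ruling.2 ⟨1, 0, by ring⟩⟩) fun a b h ↦ ?_
    exact mul_right_cancel₀ x_ne_zero (congrArg Subtype.val h)

/-- The matrix vanishes at the origin, so `r ∘ rulingCover` is the identity there. The lifts `p`,
`q` of `x`, `y` thus have determinant `1` at the origin, while `y p = x q` forces `y` times their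
determinant, hence the determinant itself, to vanish. -/
lemma not_exists_section_rulingCover (r : ruling →ₗ[A] (Fin 2 → A))
    (hr : rulingCover ∘ₗ r = LinearMap.id) : False := by
  let ev : A →+* ℂ := constantCoeff.comp (even : A →+* P)
  have hx : ev x = 0 := by simp [ev, even_x]
  have hy : ev y = 0 := by simp [ev, even_y]
  have hw : ev w = 0 := by simp [ev, even_w]
  have key (v : Fin 2 → A) (i : Fin 2) : ev (r (rulingCover v) i) = ev (v i) := by
    have : rulingCover (r (rulingCover v) - v) = 0 := by
      rw [map_sub, sub_eq_zero]
      exact congr($hr (rulingCover v))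
    obtain ⟨u, hu⟩ := exists_factorization_eq ((rulingCover_eq_zero_iff _).1 this)
    have h2 := congrArg ev (congrFun hu i)
    rw [Pi.sub_apply, map_sub, factorization_apply] at h2
    rw [eq_comm, ← sub_eq_zero, ← neg_eq_zero, neg_sub, ← h2]
    fin_cases i <;> simp [hx, hy, hw]
  have h0 : ![y, -x] = y • ![1, 0] - x • ![(0 : A), 1] := by
    ext i; fin_cases i <;> simp
  have h1 : r (rulingCover ![y, -x]) = 0 := by
    have : rulingCover ![y, -x] = 0 := by
      rw [rulingCover_eq_zero_iff]
      simp
      ring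
    rw [this, map_zero]
  rw [h0, map_sub, map_smul, map_smul, map_sub, map_smul, map_smul] at h1
  have e0 := congrFun h1 0
  have e1 := congrFun h1 1
  simp only [Pi.sub_apply, Pi.smul_apply, smul_eq_mul, Pi.zero_apply] at e0 e1
  have k00 := key ![1, 0] 0
  have k01 := key ![1, 0] 1
  have k10 := key ![0, 1] 0
  have k11 := key ![0, 1] 1
  generalize r (rulingCover ![1, 0]) = p at *
  generalize r (rulingCover ![0, 1]) = q at *
  have hdet : y * (p 0 * q 1 - p 1 * q 0) = 0 := by
    linear_combination (q 1) * e0 - (q 0) * e1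
  have := congrArg ev ((mul_eq_zero.1 hdet).resolve_left y_ne_zero)
  simp [k00, k01, k10, k11] at this
end

end A1Singularity

/-! ### Prime ideals of `A` and dévissage of finitely generated modules. -/

namespace A1Singularity

noncomputable section

open MvPolynomial

lemma even_isIntegral : (even : A →+* P).IsIntegral := by
  have key (f : P) (a : A) (h : f ^ 2 = even a) : (even : A →+* P).IsIntegralElem f :=
    ⟨Polynomial.X ^ 2 - Polynomial.C a, Polynomial.monic_X_pow_sub_C a two_ne_zero, by simp [h]⟩
  intro f
  induction f using MvPolynomial.induction_on with
  | C c =>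
    have : (C c : P) = (even : A →+* P) (algebraMap ℂ A c) := (even.commutes c).symm
    rw [this]
    exact RingHom.isIntegralElem_map _
  | add p q hp hq => exact hp.add _ hq
  | mul_X p i hp =>
    refine hp.mul _ ?_
    fin_cases i
    · exact key _ x even_x.symm
    · exact key _ w even_w.symm

/-- Otherwise `0 < (g) < q < m` would be a chain of primes of length three in a ring of dimension
two. -/
lemma isMaximal_of_span_lt {g : P} (hg : Prime g) {q : Ideal P} [hq : q.IsPrime]
    (h : Ideal.span {g} < q) : q.IsMaximal := by
  obtain ⟨m, hm, hqm⟩ := q.exists_le_maximal hq.ne_top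
  rcases hqm.eq_or_lt with rfl | hlt
  · exact hm
  exfalso
  have : (Ideal.span {g}).IsPrime := (Ideal.span_singleton_prime hg.ne_zero).2 hg
  have h0 : (⊥ : Ideal P) < Ideal.span {g} := by
    rw [bot_lt_iff_ne_bot, Ne, Ideal.span_singleton_eq_bot]
    exact hg.ne_zero
  have h1 := Ideal.height_add_one_le_of_lt_of_isPrime h0
  have h2 := Ideal.height_add_one_le_of_lt_of_isPrime h
  have h3 := Ideal.height_add_one_le_of_lt_of_isPrime hlt
  have h4 := Ideal.height_le_ringKrullDim_of_ne_top hm.ne_top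
  have h5 : ringKrullDim P = 2 := by
    rw [MvPolynomial.ringKrullDim_of_isNoetherianRing, ringKrullDim_eq_zero_of_field]
    simp
  rw [h5] at h4
  have h6 : m.height ≤ 2 := WithBot.coe_le_coe.1 h4
  have h7 : (3 : ℕ∞) ≤ m.height := by
    calc (3 : ℕ∞) = 0 + 1 + 1 + 1 := by norm_num
      _ ≤ (⊥ : Ideal P).height + 1 + 1 + 1 := by gcongr; simp
      _ ≤ _ := by
        refine le_trans ?_ h3
        gcongr
        refine le_trans ?_ h2
        gcongr
  exact absurd (h7.trans h6) (by decide)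

/-- A prime `q` of `ℂ[s, t]` over `p` contains a prime element `g`. If `q` were larger than `(g)` it
would be maximal, and so would `p`, by integrality. -/
lemma exists_prime_over (p : Ideal A) [p.IsPrime] (h0 : p ≠ ⊥) (hp : ¬ p.IsMaximal) :
    ∃ g : P, Prime g ∧ ∀ a, a ∈ p ↔ g ∣ even a := by
  let _ : Algebra A P := (even : A →+* P).toAlgebra
  have : Algebra.IsIntegral A P := ⟨even_isIntegral⟩
  obtain ⟨q, -, hq, hqp⟩ := Ideal.exists_ideal_over_prime_of_isIntegral (S := P) p ⊥ (by
    intro a ha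
    have : even a = 0 := ha
    rw [even_injective (this.trans (map_zero even).symm)]
    exact p.zero_mem)
  have hq0 : q ≠ ⊥ := by
    rintro rfl
    refine h0 (eq_bot_iff.2 fun a ha ↦ ?_)
    rw [← hqp] at ha
    exact even_injective (Eq.trans ha (map_zero even).symm)
  obtain ⟨g, hgq, hg⟩ := hq.exists_mem_prime_of_ne_bot hq0
  have hle : Ideal.span {g} ≤ q := (Ideal.span_singleton_le_iff_mem _).2 hgq
  have heq : Ideal.span {g} = q := by
    by_contra hne
    have := isMaximal_of_span_lt hg (lt_of_le_of_ne hle hne)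
    exact hp (hqp ▸ Ideal.isMaximal_comap_of_isIntegral_of_isMaximal q)
  refine ⟨g, hg, fun a ↦ ?_⟩
  rw [← hqp, ← Ideal.mem_span_singleton, heq]
  rfl

lemma exists_even_eq {f : P} (h : negVars f = f) : ∃ a, even a = f :=
  ⟨_, even_evenPart_of_negVars_eq h⟩

lemma exists_mem_ruling_of_X0_dvd {a : A} (h : X 0 ∣ even a) : a ∈ ruling := by
  obtain ⟨f, hf⟩ := h
  rw [← evenPart_even a, hf]
  exact evenPart_X0_mul_mem f

lemma X0_dvd_even_of_mem_ruling {a : A} (h : a ∈ ruling) : X 0 ∣ even a := by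
  obtain ⟨c, d, rfl⟩ := mem_ruling.1 h
  rw [map_add, map_mul, map_mul, even_x, even_y]
  exact ⟨X 0 * even c + X 1 * even d, by ring⟩

lemma negVars_eq_or_of_dvd {g : P} (hg : g ≠ 0) (h : g ∣ negVars g) :
    negVars g = g ∨ negVars g = -g := by
  obtain ⟨c, hc⟩ := h
  have h1 : c * negVars c = 1 := by
    apply mul_left_cancel₀ hg
    have := congrArg negVars hc
    rw [negVars_negVars, map_mul, hc] at this
    linear_combination -this
  -- The cofactor is a unit of a polynomial ring over a field, hence a constant, fixed by the
  -- involution and of square one.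
  obtain ⟨r, rfl⟩ : ∃ r, c = C r := by
    obtain ⟨r, -, hr⟩ := MvPolynomial.isUnit_iff_eq_C_of_isReduced.1 (IsUnit.of_mul_eq_one _ h1)
    exact ⟨r, hr⟩
  rw [← MvPolynomial.algebraMap_eq, AlgHom.commutes, ← map_mul] at h1
  have h2 : r * r = 1 := by
    apply (algebraMap ℂ P).injective
    rw [h1, map_one]
  rcases mul_self_eq_one_iff.1 h2 with rfl | rfl
  · left; rw [hc]; simp
  · right; rw [hc]; simp

/-- Let `g` be the prime element cutting out `p` and `g'` its image under `negVars`. If `g' = g`,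
then `p` is generated by `g`; if `g` does not divide `g'`, by `g g'`. If `g' = -g`, then `p`
consists of the products of `g` with odd polynomials; with `b = s g` this is the fractional ideal
`(b/x) · (x, y)`, and the second alternative states this without denominators. -/
lemma prime_eq_span_or (p : Ideal A) [p.IsPrime] (h0 : p ≠ ⊥) (hp : ¬ p.IsMaximal) :
    (∃ a, a ≠ 0 ∧ p = Ideal.span {a}) ∨
      ∃ b, b ≠ 0 ∧ (∀ a, a ∈ p ↔ ∃ i ∈ ruling, x * a = b * i) ∧
        ∀ i ∈ ruling, ∃ a, x * a = b * i := by
  obtain ⟨g, hg, hgp⟩ := exists_prime_over p h0 hp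
  have principal (f : P) (hf0 : f ≠ 0) (hf : negVars f = f) (h : ∀ a, g ∣ even a ↔ f ∣ even a) :
      ∃ a, a ≠ 0 ∧ p = Ideal.span {a} := by
    obtain ⟨a, rfl⟩ := exists_even_eq hf
    refine ⟨a, by rintro rfl; exact hf0 (map_zero _), Ideal.ext fun b ↦ ?_⟩
    rw [hgp, h, Ideal.mem_span_singleton]
    refine ⟨?_, fun h ↦ map_dvd even h⟩
    rintro ⟨c, hc⟩
    obtain ⟨c, rfl⟩ : ∃ c', even c' = c := by
      apply exists_even_eq
      apply mul_left_cancel₀ hf0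
      have := congrArg negVars hc
      rw [map_mul, negVars_even, hf] at this
      rw [← this, hc]
    exact ⟨c, even_injective (by rw [hc, map_mul])⟩
  have hX0 : (X 0 : P) ≠ 0 := X_ne_zero 0
  by_cases hdvd : g ∣ negVars g
  · rcases negVars_eq_or_of_dvd hg.ne_zero hdvd with h | h
    · exact Or.inl (principal g hg.ne_zero h fun _ ↦ Iff.rfl)
    · right
      obtain ⟨b, hb⟩ : ∃ b, even b = X 0 * g :=
        exists_even_eq (by rw [map_mul, h, negVars_X0]; ring)
      refine ⟨b, ?_, fun a ↦ ?_, fun i hi ↦ ?_⟩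
      · rintro rfl
        rw [map_zero] at hb
        exact mul_ne_zero hX0 hg.ne_zero hb.symm
      rotate_left
      · obtain ⟨f, hf⟩ := X0_dvd_even_of_mem_ruling hi
        obtain ⟨a, ha⟩ : ∃ a, even a = g * f := by
          apply exists_even_eq
          apply mul_left_cancel₀ hX0
          have := congrArg negVars hf
          rw [map_mul, negVars_even, negVars_X0] at this
          rw [map_mul, h]
          linear_combination g * hf - g * this
        refine ⟨a, even_injective ?_⟩
        rw [map_mul, map_mul, even_x, ha, hb, hf]
        ring
      rw [hgp]
      constructor
      · rintro ⟨f, hf⟩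
        obtain ⟨i, hi⟩ : ∃ i, even i = X 0 * f := by
          apply exists_even_eq
          rw [map_mul, negVars_X0]
          apply mul_left_cancel₀ hg.ne_zero
          have := congrArg negVars hf
          rw [map_mul, negVars_even, h] at this
          linear_combination (X 0) * hf - (X 0) * this
        refine ⟨i, exists_mem_ruling_of_X0_dvd ⟨f, hi⟩, even_injective ?_⟩
        rw [map_mul, map_mul, even_x, hf, hb, hi]
        ring
      · rintro ⟨i, hi, hia⟩
        obtain ⟨f, hf⟩ := X0_dvd_even_of_mem_ruling hi
        refine ⟨f, mul_left_cancel₀ (pow_ne_zero 2 hX0) ?_⟩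
        have := congrArg even hia
        rw [map_mul, map_mul, even_x, hb, hf] at this
        rw [this]
        ring
  · left
    have hg' : Prime (negVars g) := by
      let e : P ≃ₐ[ℂ] P := AlgEquiv.ofAlgHom negVars negVars (AlgHom.ext negVars_negVars)
        (AlgHom.ext negVars_negVars)
      exact (MulEquiv.prime_iff e).2 hg
    have hdvd' : ¬ negVars g ∣ g := by
      intro h
      have := map_dvd negVars h
      rw [negVars_negVars] at this
      exact hdvd this
    refine principal (g * negVars g) (mul_ne_zero hg.ne_zero hg'.ne_zero)
      (by rw [map_mul, negVars_negVars, mul_comm]) fun a ↦ ⟨?_, fun h ↦ (Dvd.intro _ rfl).trans h⟩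
    rintro ⟨f, hf⟩
    have h1 : negVars g ∣ g * f := by
      rw [← hf, ← negVars_even, hf, map_mul]
      exact Dvd.intro _ rfl
    rw [hf]
    exact mul_dvd_mul_left g ((hg'.dvd_or_dvd h1).resolve_left hdvd')

section Devissage

variable {Θ : (N : Type) → [AddCommGroup N] → [Module A N] → [Module.Finite A N] → Prop}

/-- A property of finitely generated `A`-modules that holds for zero modules and is stable under
extensions and cokernels of injective maps. -/
structure IsDevissage (Θ : (N : Type) → [AddCommGroup N] → [Module A N] → [Module.Finite A N] →
    Prop) : Prop where
  zero (N : Type) [AddCommGroup N] [Module A N] [Module.Finite A N] [Subsingleton N] : Θ N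
  middle (N₁ N₂ N₃ : Type) [AddCommGroup N₁] [Module A N₁] [Module.Finite A N₁]
    [AddCommGroup N₂] [Module A N₂] [Module.Finite A N₂] [AddCommGroup N₃] [Module A N₃]
    [Module.Finite A N₃] (f : N₁ →ₗ[A] N₂) (g : N₂ →ₗ[A] N₃) (hf : Function.Injective f)
    (hg : Function.Surjective g) (hfg : Function.Exact f g) : Θ N₁ → Θ N₃ → Θ N₂
  right (N₁ N₂ N₃ : Type) [AddCommGroup N₁] [Module A N₁] [Module.Finite A N₁]
    [AddCommGroup N₂] [Module A N₂] [Module.Finite A N₂] [AddCommGroup N₃] [Module A N₃]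
    [Module.Finite A N₃] (f : N₁ →ₗ[A] N₂) (g : N₂ →ₗ[A] N₃) (hf : Function.Injective f)
    (hg : Function.Surjective g) (hfg : Function.Exact f g) : Θ N₁ → Θ N₂ → Θ N₃

namespace IsDevissage

lemma of_equiv (h : IsDevissage Θ) {N M : Type} [AddCommGroup N] [Module A N] [Module.Finite A N]
    [AddCommGroup M] [Module A M] [Module.Finite A M] (e : N ≃ₗ[A] M) (hN : Θ N) : Θ M :=
  h.middle N M PUnit e.toLinearMap 0 e.injective (Function.surjective_to_subsingleton _)
    ((e.exact_zero_iff_surjective _).2 e.surjective) hN (h.zero _)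

lemma quotient (h : IsDevissage Θ) (hA : Θ A) (I : Ideal A) (hI : Θ I) : Θ (A ⧸ I) :=
  h.right I A (A ⧸ I) I.subtype I.mkQ Subtype.val_injective I.mkQ_surjective
    (LinearMap.exact_subtype_mkQ I) hI hA

lemma quotient_of_not_isMaximal (h : IsDevissage Θ) (hA : Θ A) (hr : Θ ruling) (p : Ideal A)
    [p.IsPrime] (hp : ¬ p.IsMaximal) : Θ (A ⧸ p) := by
  apply h.quotient hA
  by_cases h0 : p = ⊥
  · subst h0
    exact h.zero _
  obtain ⟨a, ha, rfl⟩ | ⟨b, hb, hbp, hbr⟩ := prime_eq_span_or p h0 hp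
  · exact h.of_equiv (LinearEquiv.toSpanNonzeroSingleton A A a ha) hA
  -- Since `x p = b (x, y)` inside `A`, dividing by the nonzero elements `b` and `x` identifies `(x,
  -- y)` with `p`.
  · let f : ruling →ₗ[A] A := LinearMap.mulLeft A b ∘ₗ ruling.subtype
    let g : p →ₗ[A] A := LinearMap.mulLeft A x ∘ₗ p.subtype
    have hf : Function.Injective f := fun i j h ↦ Subtype.ext (mul_left_cancel₀ hb h)
    have hg : Function.Injective g := fun i j h ↦ Subtype.ext (mul_left_cancel₀ x_ne_zero h)
    have hfg : LinearMap.range f = LinearMap.range g := by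
      ext c
      constructor
      · rintro ⟨⟨i, hi⟩, rfl⟩
        obtain ⟨a, ha⟩ := hbr i hi
        exact ⟨⟨a, (hbp a).2 ⟨i, hi, ha⟩⟩, ha⟩
      · rintro ⟨⟨a, ha⟩, rfl⟩
        obtain ⟨i, hi, hia⟩ := (hbp a).1 ha
        exact ⟨⟨i, hi⟩, hia.symm⟩
    exact h.of_equiv (LinearEquiv.ofInjective f hf ≪≫ₗ LinearEquiv.ofEq _ _ hfg ≪≫ₗ
      (LinearEquiv.ofInjective g hg).symm) hr

/-- Multiplication by `f` is injective on the domain `A/p`, with the given quotient as cokernel. -/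
lemma quotient_sup_span (h : IsDevissage Θ) (p : Ideal A) [p.IsPrime] (f : A) (hf : f ∉ p)
    (hp : Θ (A ⧸ p)) : Θ (A ⧸ (p ⊔ Ideal.span {f})) := by
  let mul : (A ⧸ p) →ₗ[A] (A ⧸ p) := LinearMap.lsmul A (A ⧸ p) f
  let q : (A ⧸ p) →ₗ[A] (A ⧸ (p ⊔ Ideal.span {f})) := Submodule.factor le_sup_left
  refine h.right _ _ _ mul q ?_ ?_ ?_ hp hp
  · rw [← LinearMap.ker_eq_bot, LinearMap.ker_eq_bot']
    intro m hm
    obtain ⟨a, rfl⟩ := Ideal.Quotient.mk_surjective m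
    have : Ideal.Quotient.mk p (f * a) = 0 := hm
    rw [Ideal.Quotient.eq_zero_iff_mem] at this ⊢
    exact (Ideal.IsPrime.mem_or_mem ‹_› this).resolve_left hf
  · exact Submodule.factor_surjective _
  · intro m
    obtain ⟨a, rfl⟩ := Ideal.Quotient.mk_surjective m
    have h1 : q (Ideal.Quotient.mk p a) = Ideal.Quotient.mk (p ⊔ Ideal.span {f}) a := rfl
    rw [h1, Ideal.Quotient.eq_zero_iff_mem, sup_comm, Ideal.mem_span_singleton_sup]
    constructor
    · rintro ⟨b, c, hc, rfl⟩
      refine ⟨Ideal.Quotient.mk p b, ?_⟩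
      change Ideal.Quotient.mk p (f * b) = _
      rw [Ideal.Quotient.eq]
      have : f * b - (b * f + c) = -c := by ring
      rw [this]
      exact p.neg_mem hc
    · rintro ⟨m, hm⟩
      obtain ⟨b, rfl⟩ := Ideal.Quotient.mk_surjective m
      have hm : Ideal.Quotient.mk p (f * b) = Ideal.Quotient.mk p a := hm
      rw [eq_comm, Ideal.Quotient.eq] at hm
      exact ⟨b, _, hm, by ring⟩

end IsDevissage

/-- The homomorphism `A → ℂ[T]` given by the line through the origin and a point of the cone. -/
def line (a b c : ℂ) (h : b ^ 2 = a * c) : A →ₐ[ℂ] Polynomial ℂ :=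
  Ideal.Quotient.liftₐ relIdeal
    (MvPolynomial.aeval ![a • Polynomial.X, b • Polynomial.X, c • Polynomial.X]) (by
    intro p hp
    rw [← RingHom.mem_ker]
    revert p
    rw [← SetLike.le_def, Ideal.span_singleton_le_iff_mem, RingHom.mem_ker]
    simp only [map_sub, map_pow, map_mul, aeval_X, Matrix.cons_val_zero,
      Matrix.cons_val_one, Matrix.cons_val]
    rw [smul_pow, h, smul_mul_smul_comm, pow_two, sub_self])

lemma algHom_ext_A {S : Type*} [CommRing S] [Algebra ℂ S] {f g : A →ₐ[ℂ] S} (hx : f x = g x)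
    (hy : f y = g y) (hw : f w = g w) : f = g := by
  refine Ideal.Quotient.algHom_ext _ (MvPolynomial.algHom_ext fun i ↦ ?_)
  fin_cases i
  · exact hx
  · exact hy
  · exact hw

section Line

variable (a b c : ℂ) (h : b ^ 2 = a * c)

lemma line_x : line a b c h x = a • Polynomial.X := by
  exact MvPolynomial.aeval_X (R := ℂ) _ (0 : Fin 3)

lemma line_y : line a b c h y = b • Polynomial.X := by
  exact MvPolynomial.aeval_X (R := ℂ) _ (1 : Fin 3)

lemma line_w : line a b c h w = c • Polynomial.X := by
  exact MvPolynomial.aeval_X (R := ℂ) _ (2 : Fin 3)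

lemma line_surjective (h0 : a ≠ 0 ∨ c ≠ 0) : Function.Surjective (line a b c h) := by
  rw [← AlgHom.range_eq_top, eq_top_iff, ← Polynomial.adjoin_X, Algebra.adjoin_le_iff,
    Set.singleton_subset_iff]
  rcases h0 with h0 | h0
  · exact ⟨a⁻¹ • x, by
      change line a b c h (a⁻¹ • x) = _
      rw [map_smul, line_x, smul_smul, inv_mul_cancel₀ h0, one_smul]⟩
  · exact ⟨c⁻¹ • w, by
      change line a b c h (c⁻¹ • w) = _
      rw [map_smul, line_w, smul_smul, inv_mul_cancel₀ h0, one_smul]⟩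

end Line

lemma exists_algHom_of_isMaximal (m : Ideal A) [m.IsMaximal] :
    ∃ ψ : A →ₐ[ℂ] ℂ, ∀ a, a ∈ m ↔ ψ a = 0 := by
  let _ : Field (A ⧸ m) := Ideal.Quotient.field m
  have : Algebra.FiniteType ℂ (A ⧸ m) :=
    Algebra.FiniteType.of_surjective (Ideal.Quotient.mkₐ ℂ m) Ideal.Quotient.mk_surjective
  have : Module.Finite ℂ (A ⧸ m) := finite_of_finite_type_of_isJacobsonRing ℂ (A ⧸ m)
  have hb : Function.Bijective (algebraMap ℂ (A ⧸ m)) :=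
    IsAlgClosed.algebraMap_bijective_of_isIntegral
  let e : ℂ ≃ₐ[ℂ] (A ⧸ m) := AlgEquiv.ofBijective (Algebra.ofId ℂ (A ⧸ m)) hb
  refine ⟨(e.symm : (A ⧸ m) →ₐ[ℂ] ℂ).comp (Ideal.Quotient.mkₐ ℂ m), fun a ↦ ?_⟩
  rw [← Ideal.Quotient.eq_zero_iff_mem]
  exact (EmbeddingLike.map_eq_zero_iff (f := e.symm)).symm

/-- Every closed point of the cone lies on a line through the origin. -/
lemma exists_line (m : Ideal A) [m.IsMaximal] :
    ∃ (l : A →ₐ[ℂ] Polynomial ℂ) (r : ℂ), Function.Surjective l ∧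
      ∀ a, a ∈ m ↔ (l a).eval r = 0 := by
  obtain ⟨ψ, hψ⟩ := exists_algHom_of_isMaximal m
  have hrel : ψ y ^ 2 = ψ x * ψ w := by rw [← map_pow, y_sq, map_mul]
  suffices ∃ (a b c r : ℂ) (h : b ^ 2 = a * c) (_ : a ≠ 0 ∨ c ≠ 0),
      ψ x = a * r ∧ ψ y = b * r ∧ ψ w = c * r by
    obtain ⟨a, b, c, r, h, h0, hx, hy, hw⟩ := this
    have heq : ψ = (Polynomial.aeval r).comp (line a b c h) := by
      apply algHom_ext_A
      · simp [line_x, hx]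
      · simp [line_y, hy]
      · simp [line_w, hw]
    refine ⟨line a b c h, r, line_surjective a b c h h0, fun p ↦ ?_⟩
    rw [hψ, heq, AlgHom.comp_apply, Polynomial.coe_aeval_eq_eval]
  by_cases h0 : ψ x ≠ 0 ∨ ψ w ≠ 0
  · exact ⟨_, _, _, 1, hrel, h0, by simp, by simp, by simp⟩
  · push Not at h0
    -- The point is the origin, and any line will do; here the line `y = w = 0`.
    refine ⟨1, 0, 0, 0, by simp, by simp, by simp [h0.1], ?_, by simp [h0.2]⟩
    rw [h0.1, zero_mul] at hrel
    simpa using hrel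

/-- A prime filtration reduces to `A/p`. If `p` is maximal, it is a point `T = r` of a line with
coordinate ring `ℂ[T]`, so `A/p` is the cokernel of multiplication by `T - r` on the quotient of `A`
by a nonmaximal prime. -/
theorem IsDevissage.holds (h : IsDevissage Θ) (hA : Θ A) (hr : Θ ruling) (N : Type)
    [AddCommGroup N] [Module A N] [hN : Module.Finite A N] : Θ N := by
  refine IsNoetherianRing.induction_on_isQuotientEquivQuotientPrime A hN
    (motive := fun N _ _ _ ↦ Θ N) (fun N _ _ _ _ ↦ h.zero N) (fun N _ _ _ p e ↦ ?_)
    (fun N₁ _ _ _ N₂ _ _ _ N₃ _ _ _ f g hf hg hfg ↦ h.middle N₁ N₂ N₃ f g hf hg hfg)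
  refine h.of_equiv e.symm ?_
  obtain ⟨p, hp⟩ := p
  change Θ (A ⧸ p)
  by_cases hm : p.IsMaximal
  · obtain ⟨l, r, hl, hlr⟩ := exists_line p
    obtain ⟨f, hf⟩ := hl (Polynomial.X - Polynomial.C r)
    have hker : (RingHom.ker l).IsPrime := RingHom.ker_isPrime _
    have hf' : f ∉ RingHom.ker l := by
      rw [RingHom.mem_ker, hf]
      exact Polynomial.X_sub_C_ne_zero r
    have heq : p = RingHom.ker l ⊔ Ideal.span {f} := by
      ext a
      rw [hlr, sup_comm, Ideal.mem_span_singleton_sup]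
      constructor
      · intro ha
        obtain ⟨g, hg⟩ := Polynomial.dvd_iff_isRoot.2 ha
        obtain ⟨b, rfl⟩ := hl g
        refine ⟨b, a - b * f, ?_, by ring⟩
        rw [RingHom.mem_ker, map_sub, map_mul, hf, hg]
        ring
      · rintro ⟨b, c, hc, rfl⟩
        rw [RingHom.mem_ker] at hc
        simp [hc, hf]
    rw [heq]
    refine h.quotient_sup_span _ f hf' (h.quotient_of_not_isMaximal hA hr _ fun hmax ↦ ?_)
    have : IsField (Polynomial ℂ) :=
      MulEquiv.isField ((Ideal.Quotient.maximal_ideal_iff_isField_quotient _).1 hmax)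
        (RingHom.quotientKerEquivOfSurjective hl).symm.toMulEquiv
    exact Polynomial.not_isField ℂ this
  · exact h.quotient_of_not_isMaximal hA hr p hm

end Devissage

end

end A1Singularity

/-! ### Coherence, rank and periodic resolution of `F`. -/

namespace A1Singularity

noncomputable section

section General

variable {R : CommRingCat.{0}}

lemma isFiniteType_of_epi_tilde (M : ModuleCat.{0} R) [h : Module.Finite R M]
    (G : (Spec R).Modules) (p : tilde M ⟶ G) [hp : Epi p] : G.IsFiniteType := by
  obtain ⟨s, hs⟩ := h.fg_top
  let g : (tilde M).GeneratingSections :=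
    (presentationTilde M (s : Set M) hs _ (Submodule.span_eq _)).generators
  have hg : Finite g.I := inferInstanceAs (Finite (s : Set M))
  let g' : G.GeneratingSections :=
    @SheafOfModules.GeneratingSections.ofEpi _ _ _ _ _ _ _ _ g p hp
  have hq : ∀ i, (g'.localGeneratorsData.generators i).IsFiniteType := fun i ↦ ⟨hg⟩
  exact SheafOfModules.IsFiniteType.mk.{0} ⟨g'.localGeneratorsData, ⟨hq⟩⟩

/-- A quasi-coherent sheaf on `Spec R` is associated with any module isomorphic to its module of
global sections. -/
def tildeIso (G : (Spec R).Modules) (hG : G.IsQuasicoherent) {N : ModuleCat.{0} R}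
    (e : N ≅ (moduleSpecΓFunctor (R := R)).obj G) : (tilde.functor R).obj N ≅ G :=
  have hi : IsIso G.fromTildeΓ := (isQuasicoherent_iff_isIso_fromTildeΓ G).1 hG
  (tilde.functor R).mapIso e ≪≫ @asIso _ _ _ _ G.fromTildeΓ hi

lemma isCoherent_of_finite (G : (Spec R).Modules) (hG : G.IsQuasicoherent) {N : ModuleCat.{0} R}
    [Module.Finite R N] (e : N ≅ (moduleSpecΓFunctor (R := R)).obj G) : isCoherent _ G :=
  ⟨hG, @isFiniteType_of_epi_tilde R N _ G (tildeIso G hG e).hom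
    (show Epi (tildeIso G hG e).hom from inferInstance)⟩

lemma exact_comp_iso {C : Type*} [Category C] [HasZeroMorphisms C] {S : ShortComplex C}
    (hS : S.Exact) {Y : C} (e : S.X₃ ≅ Y) :
    (ShortComplex.mk S.f (S.g ≫ e.hom) (by simp)).Exact :=
  ShortComplex.exact_of_iso (ShortComplex.isoMk (S₁ := S) (S₂ := ShortComplex.mk S.f (S.g ≫ e.hom) (by simp))
    (Iso.refl _) (Iso.refl _) e (by simp) (by simp)) hS

lemma exists_periodic_resolution {M N : ModuleCat.{0} R} {G : (Spec R).Modules}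
    (e : (tilde.functor R).obj N ≅ G) (f : M ⟶ M) (g : M ⟶ N)
    (hff : Function.Exact f f) (hfg : Function.Exact f g) (hg : Function.Surjective g) :
    ∃ (p : (tilde.functor R).obj M ⟶ G) (h₀ : (tilde.functor R).map f ≫ p = 0)
      (h₁ : (tilde.functor R).map f ≫ (tilde.functor R).map f = 0),
      Epi p ∧ (ShortComplex.mk _ _ h₀).Exact ∧ (ShortComplex.mk _ _ h₁).Exact := by
  have z₀ : f ≫ g = 0 := ModuleCat.hom_ext (LinearMap.ext hfg.apply_apply_eq_zero)
  have z₁ : f ≫ f = 0 := ModuleCat.hom_ext (LinearMap.ext hff.apply_apply_eq_zero)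
  have e₀ : (ShortComplex.mk f g z₀).Exact :=
    (ShortComplex.ShortExact.moduleCat_exact_iff_function_exact _).2 hfg
  have e₁ : (ShortComplex.mk f f z₁).Exact :=
    (ShortComplex.ShortExact.moduleCat_exact_iff_function_exact _).2 hff
  have : Epi g := (ModuleCat.epi_iff_surjective _).2 hg
  exact ⟨(tilde.functor R).map g ≫ e.hom,
    by rw [← Category.assoc, ← Functor.map_comp, z₀, Functor.map_zero, zero_comp],
    by rw [← Functor.map_comp, z₁, Functor.map_zero],
    epi_comp _ _, exact_comp_iso (e₀.map (tilde.functor R)) e, e₁.map (tilde.functor R)⟩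

end General

/-- The ideal `ruling` as an object of the category of modules. -/
abbrev rulingMod : ModuleCat.{0} (CommRingCat.of A) := ModuleCat.of (CommRingCat.of A) ruling

instance : Module.Finite (CommRingCat.of A) rulingMod :=
  inferInstanceAs (Module.Finite A ruling)

/-- The module of global sections of `F` is isomorphic to the ideal `ruling`. -/
def rulingIso : rulingMod ≅ (moduleSpecΓFunctor (R := CommRingCat.of A)).obj F :=
  LinearEquiv.toModuleIso (R := CommRingCat.of A) rulingEquiv

/-- The sheaf `F` is associated with the ideal `ruling`. -/
def tildeRuling : (tilde.functor (CommRingCat.of A)).obj rulingMod ≅ F :=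
  tildeIso (R := CommRingCat.of A) F isQuasicoherent_F rulingIso

lemma isCoherent_F : isCoherent X₂ F :=
  isCoherent_of_finite (R := CommRingCat.of A) F isQuasicoherent_F rulingIso

lemma rank_F : rank F = 1 := by
  rw [← rank_ruling]
  exact rulingEquiv.rank_eq.symm

lemma exists_resolution_F : ∃ (ε : O₂ ⟶ F) (h₀ : φ ≫ ε = 0) (h₁ : φ ≫ φ = 0),
    Epi ε ∧ (ShortComplex.mk φ ε h₀).Exact ∧ (ShortComplex.mk φ φ h₁).Exact :=
  exists_periodic_resolution (R := CommRingCat.of A) tildeRuling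
    (ModuleCat.ofHom (R := CommRingCat.of A) factorization)
    (ModuleCat.ofHom (R := CommRingCat.of A) rulingCover)
    exact_factorization exact_factorization_rulingCover rulingCover_surjective

end

end A1Singularity

/-! ### Projectivity of the sections of locally free coherent sheaves. -/

namespace A1Singularity

noncomputable section

variable {R : CommRingCat.{0}}

section SheafOfModules

universe u v₁ u₁

variable {C : Type u₁} [Category.{v₁} C] {J : GrothendieckTopology C} {S : Sheaf J RingCat.{u}}

lemma isIso_ofEpi_π [HasWeakSheafify J AddCommGrpCat.{u}]
    [J.WEqualsLocallyBijective AddCommGrpCat.{u}] {M N : SheafOfModules.{u} S}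
    (σ : M.GeneratingSections) (p : M ⟶ N) (hp : Epi p) (hσ : IsIso σ.π) (hp' : IsIso p) :
    IsIso (σ.ofEpi p).π := by
  rw [SheafOfModules.GeneratingSections.ofEpi_π]
  exact IsIso.comp_isIso' hσ hp'

lemma isIso_map_π {C' : Type*} [Category C'] {J' : GrothendieckTopology C'}
    {S' : Sheaf J' RingCat.{u}} [HasSheafify J' AddCommGrpCat.{u}]
    [J'.WEqualsLocallyBijective AddCommGrpCat.{u}] [HasWeakSheafify J AddCommGrpCat.{u}]
    [J.WEqualsLocallyBijective AddCommGrpCat.{u}] {M : SheafOfModules.{u} S}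
    (G : M.GeneratingSections) (F : SheafOfModules.{u} S ⥤ SheafOfModules.{u} S')
    (hF : PreservesColimitsOfSize.{u, u} F)
    (η : SheafOfModules.unit S' ≅ F.obj (SheafOfModules.unit S)) (hG : IsIso G.π) :
    IsIso (G.map F η).π :=
  inferInstance

variable [∀ X, HasWeakSheafify (J.over X) AddCommGrpCat.{u}]
  [∀ X, (J.over X).WEqualsLocallyBijective AddCommGrpCat.{u}]

lemma isLocallyFree_of_iso {M N : SheafOfModules.{u} S} (e : M ≅ N)
    (hM : M.IsLocallyFree) : N.IsLocallyFree := by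
  obtain ⟨q, hq⟩ := hM
  let f (i : q.I) : M.over (q.X i) ⟶ N.over (q.X i) := (SheafOfModules.overFunctor S (q.X i)).map e.hom
  have hf (i : q.I) : IsIso (f i) :=
    Functor.map_isIso (SheafOfModules.overFunctor S (q.X i)) e.hom
  let q' : SheafOfModules.LocalGeneratorsData N :=
    { I := q.I
      X := q.X
      coversTop := q.coversTop
      generators i := (q.generators i).ofEpi (f i) }
  exact ⟨q', ⟨fun i ↦ isIso_ofEpi_π (q.generators i) (f i) inferInstance (hq.isIso i) (hf i)⟩⟩

end SheafOfModules

lemma projective_of_generatingSections (F : (Spec R).Modules) (hF : F.IsQuasicoherent)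
    (G : F.GeneratingSections) (hG : IsIso G.π) :
    Module.Projective R ((moduleSpecΓFunctor (R := R)).obj F) := by
  let N := (moduleSpecΓFunctor (R := R)).obj F
  have hi : IsIso F.fromTildeΓ := (isQuasicoherent_iff_isIso_fromTildeΓ F).1 hF
  let e : (tilde.functor R).obj N ≅ F := @asIso _ _ _ _ F.fromTildeΓ hi
  let fr : (Spec R).Modules := SheafOfModules.free G.I
  let t : (tilde.functor R).obj (ModuleCat.of R (G.I →₀ R)) ≅ fr := tildeFinsupp G.I
  let p : fr ≅ F := @asIso _ _ _ _ G.π hG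
  let φ : ModuleCat.of R (G.I →₀ R) ≅ N := (tilde.functor R).preimageIso (t ≪≫ p ≪≫ e.symm)
  exact Module.Projective.of_equiv φ.toLinearEquiv

lemma isIso_restrictGenerators_π {X Y : Scheme.{0}} (M : X.Modules) (W : X.Opens) (f : Y ⟶ X)
    [IsOpenImmersion f] (h : f.opensRange ≤ W) (G : (M.over W).GeneratingSections)
    (hG : IsIso G.π) : IsIso (restrictGenerators M W f h G).π := by
  unfold restrictGenerators
  refine isIso_ofEpi_π _ _ _ ?_ ?_
  · exact isIso_map_π _ _ _ _ hG
  · exact Iso.isIso_hom _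

lemma flat_of_flat_localization {R S Q N : Type*} [CommRing R] [CommRing S] (a : R)
    [Algebra R S] [IsLocalization.Away a S] [AddCommGroup Q] [Module R Q]
    [AddCommGroup N] [Module S N] [Module.Flat S N] (e : N ≃+ Q)
    (he : ∀ (r : R) (n : N), e (algebraMap R S r • n) = r • e n) : Module.Flat R Q := by
  let _ : Module R N := Module.compHom N (algebraMap R S)
  have : IsScalarTower R S N := .of_algebraMap_smul fun _ _ ↦ rfl
  let e' : N ≃ₗ[R] Q := { e with map_smul' := he }
  have : Module.Flat R S := IsLocalization.flat S (.powers a)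
  have : Module.Flat R N := .trans R S N
  exact Module.Flat.of_linearEquiv e'.symm

/-- Flatness can be tested on a cover by basic opens. There the sheaf is free, so its sections are
projective over `R_a`, hence flat over `R`. Finite presentation later upgrades flat to projective.
-/
lemma flat_of_isLocallyFree (G : Coh R) (hG : SheafOfModules.IsLocallyFree G.obj) :
    Module.Flat R (secTop G.obj) := by
  obtain ⟨q, hq⟩ := hG
  let t : Set R := {a | ∃ i, dopen a ≤ q.X i}
  have ht : Ideal.span t = ⊤ := by
    rw [← PrimeSpectrum.zeroLocus_empty_iff_eq_top, PrimeSpectrum.zeroLocus_span,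
      Set.eq_empty_iff_forall_notMem]
    intro p hp
    have hc : IsOpenCover q.X := (Opens.coversTop_iff _ _).1 q.coversTop
    obtain ⟨i, hi⟩ := hc.exists_mem p
    obtain ⟨_, ⟨_, ⟨r, rfl⟩, rfl⟩, hxr, hrU⟩ :=
      PrimeSpectrum.isBasis_basic_opens.exists_subset_of_mem_open hi (q.X i).2
    exact hxr (hp ⟨i, hrU⟩)
  have hF := G.property.1
  have hloc (a : R) := (isIso_fromTildeΓ_iff_isLocalizing G.obj).1
    ((isQuasicoherent_iff_isIso_fromTildeΓ G.obj).1 hF) a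
  have key (a : t) : Module.Flat R (secD G.obj a) := by
    obtain ⟨a, i, hi⟩ := a
    have h' : (Spec.map (awayMap R a)).opensRange ≤ q.X i := by
      rw [← Scheme.Hom.image_top_eq_opensRange, image_awayMap]; exact hi
    have := projective_of_generatingSections _
      (isQuasicoherent_restrict (Spec.map (awayMap R a)) G.obj hF) _
      (isIso_restrictGenerators_π G.obj (q.X i) (Spec.map (awayMap R a)) h'
        (q.generators i) (hq.isIso i))
    have : Module.Flat (awayRing R a) (secTop (G.obj.restrict (Spec.map (awayMap R a)))) :=
      @Module.Flat.of_projective _ _ _ _ _ this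
    exact flat_of_flat_localization (S := awayRing R a) a (sectionsAway G.obj a)
      (sectionsAway_smul G.obj a)
  exact @Module.flat_of_isLocalized_span R R _ _ _ (secTop G.obj) _ _ _ _ t ht
    (fun a ↦ secD G.obj a) _ _ _ _ _ (fun a ↦ hloc a) key

lemma projective_sections_of_isLocallyFree [IsNoetherianRing R] (G : Coh R)
    (hG : SheafOfModules.IsLocallyFree G.obj) :
    Module.Projective R (secTop G.obj) := by
  have := flat_of_isLocallyFree G hG
  have := finite_of_isCoherent G.obj G.property
  have := Module.finitePresentation_of_finite R (secTop G.obj)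
  exact Module.Flat.projective_of_finitePresentation

end

end A1Singularity

/-! ### Exact sequences and projectives in the category of coherent sheaves. -/

namespace A1Singularity

noncomputable section

variable {R : CommRingCat.{0}} [IsNoetherianRing R]

/-- The coherent sheaf associated with a finitely generated module. -/
abbrev cohOf (R : CommRingCat.{0}) (N : Type) [AddCommGroup N] [Module R N] [Module.Finite R N] : Coh R :=
  (tildeFG R).obj (FGModuleCat.of R N)

section

variable {M N L : Type} [AddCommGroup M] [Module R M] [Module.Finite R M]
  [AddCommGroup N] [Module R N] [Module.Finite R N] [AddCommGroup L] [Module R L]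
  [Module.Finite R L]

/-- The morphism of coherent sheaves associated with a linear map. -/
abbrev cohMap (f : M →ₗ[R] N) : cohOf R M ⟶ cohOf R N := (tildeFG R).map (FGModuleCat.ofHom f)

instance : (tildeFG R).Additive := Functor.additive_of_preserves_binary_products _

lemma cohMap_comp_eq_zero (f : M →ₗ[R] N) (g : N →ₗ[R] L) (h : g ∘ₗ f = 0) :
    cohMap f ≫ cohMap g = 0 := by
  rw [← Functor.map_comp]
  exact (congrArg (tildeFG R).map (FGModuleCat.hom_ext h)).trans ((tildeFG R).map_zero _ _)

lemma shortExact_coh (f : M →ₗ[R] N) (g : N →ₗ[R] L) (h : g ∘ₗ f = 0)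
    (hf : Function.Injective f) (hfg : Function.Exact f g) (hg : Function.Surjective g) :
    (ShortComplex.mk (cohMap f) (cohMap g) (cohMap_comp_eq_zero f g h)).ShortExact := by
  let S : ShortComplex (FGModuleCat R) :=
    ShortComplex.mk (FGModuleCat.ofHom f) (FGModuleCat.ofHom g) (FGModuleCat.hom_ext h)
  have hS : S.ShortExact :=
    { exact := (S.exact_map_iff_of_faithful (forget₂ (FGModuleCat R) (ModuleCat R))).1
        ((ShortComplex.ShortExact.moduleCat_exact_iff_function_exact _).2 hfg)
      mono_f := (forget₂ (FGModuleCat R) (ModuleCat R)).mono_of_mono_map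
        ((ModuleCat.mono_iff_injective _).2 hf)
      epi_g := (forget₂ (FGModuleCat R) (ModuleCat R)).epi_of_epi_map
        ((ModuleCat.epi_iff_surjective _).2 hg) }
  exact hS.map_of_exact (tildeFG R)

end

lemma projective_cohOf (N : Type) [AddCommGroup N] [Module R N] [Module.Finite R N]
    [Module.Projective R N] : Projective (cohOf R N) := by
  refine ((tildeFG R).asEquivalence.map_projective_iff (FGModuleCat.of R N)).2 ?_
  exact (forget₂ (FGModuleCat R) (ModuleCat R)).projective_of_map_projective
    ((IsProjective.iff_projective N).1 inferInstance)

lemma projective_of_isLocallyFree (G : Coh R) (hG : SheafOfModules.IsLocallyFree G.obj) :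
    Projective G := by
  have h : IsIso G.obj.fromTildeΓ := (isQuasicoherent_iff_isIso_fromTildeΓ G.obj).1 G.property.1
  let N : FGModuleCat R := ⟨(moduleSpecΓFunctor (R := R)).obj G.obj,
    finite_of_isCoherent G.obj G.property⟩
  let e : (tildeFG R).obj N ≅ G := (isCoherent (Spec R)).isoMk (@asIso _ _ _ _ G.obj.fromTildeΓ h)
  have : Module.Projective R N := projective_sections_of_isLocallyFree G hG
  exact Projective.of_iso e (@projective_cohOf R _ N _ _ N.property this)

end

end A1Singularity

/-! ### Morphisms into low degrees, and zero objects of Verdier quotients. -/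

namespace A1Singularity

noncomputable section

section Derived

open Pretriangulated DerivedCategory ZeroObject

variable {C : Type*} [Category C] [Abelian C] [HasDerivedCategory C]

/-- A bounded above complex of projectives is K-projective, so `f` is represented by a map of
complexes. Its target may be taken in degrees at most `m`, where the source vanishes. -/
lemma hom_eq_zero_of_projective (P : CochainComplex C ℤ) (a b m : ℤ) [P.IsStrictlyGE a]
    [P.IsStrictlyLE b] (hP : ∀ n, Projective (P.X n)) (hm : m < a) {Y : DerivedCategory C}
    [hY : Y.IsLE m] (f : Q.obj P ⟶ Y) : f = 0 := by
  obtain ⟨K, hK, ⟨e⟩⟩ := exists_iso_Q_obj_of_isLE Y m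
  have : P.IsKProjective := CochainComplex.isKProjective_of_projective P b
  obtain ⟨g, hg⟩ := (CochainComplex.IsKProjective.Qh_map_bijective P
    ((HomotopyCategory.quotient _ _).obj K)).surjective
      ((quotientCompQhIso C).hom.app P ≫ f ≫ e.hom ≫ (quotientCompQhIso C).inv.app K)
  obtain ⟨h, rfl⟩ := (HomotopyCategory.quotient C (.up ℤ)).map_surjective g
  have h0 : h = 0 := by
    ext i
    by_cases hi : i < a
    · exact (P.isZero_of_isStrictlyGE a i hi).eq_of_src _ _
    · exact (K.isZero_of_isStrictlyLE m i (by lia)).eq_of_tgt _ _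
  rw [h0, Functor.map_zero, Functor.map_zero] at hg
  rw [← cancel_mono e.hom, ← cancel_mono ((quotientCompQhIso C).inv.app K),
    ← cancel_epi ((quotientCompQhIso C).hom.app P)]
  simp only [Category.assoc, ← hg, zero_comp, comp_zero]

lemma single_hom_eq_zero_of_projective (X : C) [Projective X] (m : ℤ) (hm : m < 0)
    {Y : DerivedCategory C} [Y.IsLE m] (f : (singleFunctor C 0).obj X ⟶ Y) : f = 0 := by
  let e := (singleFunctorIsoCompQ C 0).app X
  rw [← cancel_epi e.inv, comp_zero]
  refine hom_eq_zero_of_projective ((CochainComplex.singleFunctor C 0).obj X) 0 0 m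
    (fun n ↦ ?_) hm _
  by_cases hn : n = 0
  · subst hn
    exact Projective.of_iso (HomologicalComplex.singleObjXSelf (.up ℤ) 0 X).symm inferInstance
  · exact (HomologicalComplex.isZero_single_obj_X (.up ℤ) 0 X n hn).projective

variable (C) in
/-- The objects of the derived category without nonzero morphisms to objects concentrated in
sufficiently low degrees. -/
def homBounded : ObjectProperty (DerivedCategory C) := fun K ↦
  ∃ a : ℤ, ∀ (Y : DerivedCategory C) (_ : Y.IsLE a) (f : K ⟶ Y), f = 0

instance : (homBounded C).IsStableUnderRetracts where
  of_retract {X Y} r := by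
    rintro ⟨a, ha⟩
    refine ⟨a, fun Z hZ f ↦ ?_⟩
    rw [← Category.id_comp f, ← r.retract, Category.assoc, ha Z hZ (r.r ≫ f), comp_zero]

instance : (homBounded C).IsTriangulated where
  exists_zero := ⟨0, isZero_zero _, 0, fun _ _ _ ↦ (isZero_zero _).eq_of_src _ _⟩
  isStableUnderShiftBy n :=
    ⟨by
      rintro K ⟨a, ha⟩
      refine ⟨a - n, fun Y hY f ↦ (shiftFunctor _ (-n)).map_injective ?_⟩
      have := TStructure.t.isLE_shift Y (a - n) (-n) a (by lia)
      let e : K ≅ K⟦n⟧⟦-n⟧ := (shiftEquiv (DerivedCategory C) n).unitIso.app K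
      rw [← cancel_epi e.hom, Functor.map_zero, comp_zero]
      exact ha _ this _⟩
  ext₂' T hT := by
    rintro ⟨a, ha⟩ ⟨b, hb⟩
    refine ObjectProperty.le_isoClosure _ _ ⟨min a b, fun Y hY f ↦ ?_⟩
    have h1 : Y.IsLE a := TStructure.t.isLE_of_le Y (min a b) a (min_le_left _ _)
    have h2 : Y.IsLE b := TStructure.t.isLE_of_le Y (min a b) b (min_le_right _ _)
    obtain ⟨g, rfl⟩ := T.yoneda_exact₂ hT f (ha Y h1 _)
    rw [hb Y h2 g, comp_zero]

lemma homBounded_Q_obj (P : CochainComplex C ℤ) (a b : ℤ) [P.IsStrictlyGE a]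
    [P.IsStrictlyLE b] (hP : ∀ n, Projective (P.X n)) : homBounded C (Q.obj P) :=
  ⟨a - 1, fun _ _ f ↦ hom_eq_zero_of_projective P a b (a - 1) hP (by lia) f⟩

/-- Dimension shifting: the connecting morphism is nonzero because the sequence does not split, and
`X₁ ≅ X₃` allows it to be composed with its own shifts indefinitely. -/
lemma not_homBounded_of_shortExact {S : ShortComplex C} (hS : S.ShortExact) [Projective S.X₂]
    (e : S.X₁ ≅ S.X₃) (hsplit : ∀ s : S.X₃ ⟶ S.X₂, s ≫ S.g ≠ 𝟙 _) :
    ¬ homBounded C ((singleFunctor C 0).obj S.X₃) := by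
  let T := hS.singleTriangle
  have hT : T ∈ distTriang _ := hS.singleTriangle_distinguished
  have key (n : ℕ) : ∃ (Y : DerivedCategory C) (_ : Y.IsLE (-n - 1))
      (f : (singleFunctor C 0).obj S.X₃ ⟶ Y), f ≠ 0 := by
    induction n with
    | zero =>
      refine ⟨((singleFunctor C 0).obj S.X₁)⟦(1 : ℤ)⟧, TStructure.t.isLE_shift _ 0 _ _ (by lia),
        T.mor₃, fun h ↦ ?_⟩
      obtain ⟨s, hs⟩ := T.coyoneda_exact₃ hT (𝟙 _) ((congrArg (_ ≫ ·) h).trans comp_zero)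
      obtain ⟨s', rfl⟩ := (singleFunctor C 0).map_surjective s
      refine hsplit s' ((singleFunctor C 0).map_injective ?_)
      rw [Functor.map_comp, CategoryTheory.Functor.map_id]
      exact hs.symm
    | succ n ih =>
      obtain ⟨Y, hY, f, hf⟩ := ih
      refine ⟨Y⟦(1 : ℤ)⟧, TStructure.t.isLE_shift _ (-n - 1) _ _ (by push_cast; lia),
        T.mor₃ ≫ ((singleFunctor C 0).map e.hom ≫ f)⟦1⟧', fun h ↦ hf ?_⟩
      -- If the composite vanished, the shifted morphism would factor through `X₂[1]`, and the
      -- projective `X₂` has no nonzero morphism to `Y`, which lies in negative degrees.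
      obtain ⟨g, hg⟩ := T.rotate.yoneda_exact₃ (rot_of_distTriang _ hT)
        (((singleFunctor C 0).map e.hom ≫ f)⟦1⟧') h
      obtain ⟨g', rfl⟩ := (shiftFunctor (DerivedCategory C) (1 : ℤ)).map_surjective g
      have hg' : g' = 0 := by
        exact single_hom_eq_zero_of_projective S.X₂ (-n - 1) (by lia) g'
      rw [hg', Functor.map_zero, comp_zero] at hg
      have := (shiftFunctor (DerivedCategory C) (1 : ℤ)).map_injective (hg.trans (Functor.map_zero _ _ _).symm)
      rwa [← cancel_epi ((singleFunctor C 0).map e.hom), comp_zero]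
  rintro ⟨a, ha⟩
  obtain ⟨Y, hY, f, hf⟩ := key a.natAbs
  have : Y.IsLE a := TStructure.t.isLE_of_le Y (-a.natAbs - 1) a (by lia)
  exact hf (ha Y this f)

end Derived

section Verdier

open Pretriangulated ZeroObject

variable {C : Type*} [Category C] [HasZeroObject C] [HasShift C ℤ] [Preadditive C]
    [∀ n : ℤ, (shiftFunctor C n).Additive] [Pretriangulated C] [IsTriangulated C]

lemma isZero_Q_obj_of_prop (W : ObjectProperty C) [W.IsTriangulated] (X : C) (hX : W X) :
    IsZero (W.trW.Q.obj X) := by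
  have h : W.trW (0 : 0 ⟶ X) := ObjectProperty.trW.mk _ (contractible_distinguished₁ X) hX
  have := Localization.inverts W.trW.Q W.trW _ h
  exact IsZero.of_iso (W.trW.Q.map_isZero (isZero_zero C)) (asIso (W.trW.Q.map (0 : 0 ⟶ X))).symm

/-- The identity of `X` becomes zero after composition with some `s` whose cone lies in `W`, so `s =
0`. The cone of a zero morphism has `X[1]` as a retract. -/
lemma prop_of_isZero_Q_obj (W : ObjectProperty C) [W.IsTriangulated] [W.IsStableUnderRetracts]
    (X : C) (hX : IsZero (W.trW.Q.obj X)) : W X := by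
  have h : W.trW.Q.map (𝟙 X) = W.trW.Q.map 0 := hX.eq_of_src _ _
  obtain ⟨Y, s, hs, h⟩ := (MorphismProperty.map_eq_iff_postcomp W.trW.Q W.trW _ _).1 h
  obtain rfl : s = 0 := by simpa using h
  obtain ⟨Z, g, δ, hT, hZ⟩ := (W.trW_iff _).1 hs
  obtain ⟨r, hr⟩ := Triangle.coyoneda_exact₁ _ hT (𝟙 (X⟦(1 : ℤ)⟧))
    ((congrArg (_ ≫ ·) ((shiftFunctor C (1 : ℤ)).map_zero X Y)).trans comp_zero)
  have : W (X⟦(1 : ℤ)⟧) := W.prop_of_retract ⟨r, δ, hr.symm⟩ hZ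
  exact W.prop_of_iso ((shiftEquiv C (1 : ℤ)).unitIso.symm.app X) (W.le_shift (-1) _ this)

end Verdier

end

end A1Singularity

/-! ### Nonvanishing of `F` in the singularity category. -/

namespace A1Singularity

noncomputable section

section Perfect

variable {R : CommRingCat.{0}} [IsNoetherianRing R]

lemma isPerfect_le_homBounded :
    isPerfect R ≤ (homBounded (Coh R)).inverseImage DerivedCategory.Bounded.ι := by
  rintro K ⟨P, ⟨a, b, ha, hb⟩, hP, ⟨e⟩⟩
  exact (homBounded (Coh R)).prop_of_iso e.symm
    (homBounded_Q_obj P a b fun n ↦ projective_of_isLocallyFree _ (hP n))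

instance : ((homBounded (Coh R)).inverseImage
    DerivedCategory.Bounded.ι).IsStableUnderRetracts where
  of_retract r h := (homBounded (Coh R)).prop_of_retract (r.map DerivedCategory.Bounded.ι) h

lemma homBounded_of_isZero (G : Coh R) (hG : IsZero (inDSg G)) :
    homBounded (Coh R) ((DerivedCategory.singleFunctor (Coh R) 0).obj G) :=
  ((isPerfect R).triangEnvelope_le_iff.2 isPerfect_le_homBounded) _
    (prop_of_isZero_Q_obj (isPerfect R).triangEnvelope (inDb G) hG)

lemma isZero_inDSg_of_isPerfect (G : Coh R) (hG : isPerfect R (inDb G)) : IsZero (inDSg G) :=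
  isZero_Q_obj_of_prop _ _ ((isPerfect R).le_triangEnvelope _ hG)

lemma not_homBounded_of_exact {M N : Type} [AddCommGroup M] [Module R M] [Module.Finite R M]
    [AddCommGroup N] [Module R N] [Module.Finite R N] [Module.Projective R N] (f : M →ₗ[R] N)
    (g : N →ₗ[R] M) (hf : Function.Injective f) (hfg : Function.Exact f g)
    (hg : Function.Surjective g) (hsplit : ∀ r : M →ₗ[R] N, g ∘ₗ r ≠ LinearMap.id) :
    ¬ homBounded (Coh R) ((DerivedCategory.singleFunctor (Coh R) 0).obj (cohOf R M)) := by
  have hS := shortExact_coh f g hfg.linearMap_comp_eq_zero hf hfg hg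
  have : Projective (cohOf R N) := projective_cohOf N
  refine not_homBounded_of_shortExact hS (Iso.refl _) fun s hs ↦ ?_
  obtain ⟨r, rfl⟩ := (tildeFG R).map_surjective s
  refine hsplit r.hom.hom ?_
  have h : r ≫ FGModuleCat.ofHom g = 𝟙 _ := (tildeFG R).map_injective
    (((tildeFG R).map_comp _ _).trans (hs.trans
      ((tildeFG R).map_id (FGModuleCat.of R M)).symm))
  exact congrArg (fun k ↦ k.hom.hom) h

end Perfect

/-- The coherent sheaf associated with the ideal `ruling`. -/
abbrev rulingSheaf : Coh (CommRingCat.of A) :=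
  @cohOf (CommRingCat.of A) ruling _ _ (inferInstanceAs (Module.Finite A ruling))

/-- The coherent sheaf `F` is associated with the ideal `ruling`. -/
def rulingSheafIso (hF : isCoherent X₂ F) : rulingSheaf ≅ ⟨F, hF⟩ :=
  (isCoherent X₂).isoMk tildeRuling

lemma not_homBounded_ruling : ¬ homBounded (Coh (CommRingCat.of A))
    ((DerivedCategory.singleFunctor (Coh (CommRingCat.of A)) 0).obj rulingSheaf) := by
  let i : ruling →ₗ[A] (Fin 2 → A) := (LinearMap.ker rulingCover).subtype ∘ₗ rulingEquivKer
  have hi : Function.Injective i := Subtype.val_injective.comp rulingEquivKer.injective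
  have hex : Function.Exact i rulingCover := by
    rw [LinearMap.exact_iff, LinearMap.range_comp, LinearEquiv.range, Submodule.map_top,
      Submodule.range_subtype]
  exact not_homBounded_of_exact (R := CommRingCat.of A) i rulingCover hi hex rulingCover_surjective
    not_exists_section_rulingCover

lemma not_isZero_inDSg_F (hF : isCoherent X₂ F) :
    ¬ IsZero (inDSg (R := .of A) ⟨F, hF⟩) := fun h ↦
  not_homBounded_ruling ((homBounded _).prop_of_iso
    ((DerivedCategory.singleFunctor _ 0).mapIso (rulingSheafIso hF).symm)
    (homBounded_of_isZero (R := .of A) _ h))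

end

end A1Singularity

/-! ### Generation of the singularity category by `F`. -/

namespace A1Singularity

noncomputable section

section Derived

open Pretriangulated DerivedCategory

variable {C : Type*} [Category C] [Abelian C] [HasDerivedCategory C]

/-- Induction on the length of the range of cohomological degrees, splitting off the top degree by a
truncation triangle. -/
lemma prop_of_bounded (W : ObjectProperty (DerivedCategory C)) [W.IsTriangulated]
    [W.IsClosedUnderIsomorphisms] (hW : ∀ X : C, W ((singleFunctor C 0).obj X))
    (K : DerivedCategory C) (hK : TStructure.t.bounded K) : W K := by
  have hs (n : ℤ) (X : C) : W ((singleFunctor C n).obj X) :=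
    W.prop_of_iso (((singleFunctors C).shiftIso (-n) n 0 (by lia)).app X) (W.le_shift (-n) _ (hW X))
  obtain ⟨⟨a, ha⟩, ⟨b, hb⟩⟩ := hK
  -- The degrees run from `a` to `a + n - 1`, so `n = 0` is the empty range and `K` is zero.
  have key (n : ℕ) : ∀ (K : DerivedCategory C), K.IsGE a → K.IsLE (a + n - 1) → W K := by
    induction n with
    | zero =>
      intro K h1 h2
      exact W.prop_of_isZero (TStructure.t.isZero K (a + (0 : ℕ) - 1) a (by simp))
    | succ n ih =>
      intro K h1 h2
      refine W.ext_of_isTriangulatedClosed₂ _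
        (TStructure.t.triangleLEGE_distinguished (a + n - 1) (a + n) (by lia) K) ?_ ?_
      · exact ih ((TStructure.t.truncLE (a + n - 1)).obj K) inferInstance inferInstance
      · have h3 : ((TStructure.t.truncGE (a + n)).obj K).IsGE (a + n) := inferInstance
        have h4 : ((TStructure.t.truncGE (a + n)).obj K).IsLE (a + n) := by
          have := TStructure.t.isLE_of_le K (a + (n + 1 : ℕ) - 1) (a + n) (by push_cast; lia)
          infer_instance
        obtain ⟨Y, ⟨e⟩⟩ := exists_iso_singleFunctor_obj_of_isGE_of_isLE
          ((TStructure.t.truncGE (a + n)).obj K) (a + n)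
        exact W.prop_of_iso e.symm (hs _ Y)
  exact key (b - a + 1).toNat K ha (TStructure.t.isLE_of_le K b _ (by lia))

end Derived

section Perfect

variable {R : CommRingCat.{0}} [IsNoetherianRing R]

lemma isPerfect_of_isLocallyFree (G : Coh R) (hG : SheafOfModules.IsLocallyFree G.obj) :
    isPerfect R (inDb G) := by
  refine ⟨(CochainComplex.singleFunctor (Coh R) 0).obj G, ⟨0, 0, inferInstance, inferInstance⟩,
    fun n ↦ ?_, ⟨(DerivedCategory.singleFunctorIsoCompQ (Coh R) 0).app G⟩⟩
  by_cases hn : n = 0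
  · subst hn
    exact isLocallyFree_of_iso ((isCoherent (Spec R)).ι.mapIso
      (HomologicalComplex.singleObjXSelf (.up ℤ) 0 G).symm) hG
  · obtain ⟨Z, hZ, hZ'⟩ := exists_isZero_isLocallyFree R
    exact isLocallyFree_of_iso ((isCoherent (Spec R)).ι.mapIso
      (hZ.iso (HomologicalComplex.isZero_single_obj_X (.up ℤ) 0 G n hn))) hZ'

lemma isPerfect_structureSheaf : isPerfect R (inDb (cohOf R R)) := by
  refine isPerfect_of_isLocallyFree _ ?_
  let fr : (Spec R).Modules := SheafOfModules.free PUnit.{1}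
  have h : SheafOfModules.IsLocallyFree fr :=
    inferInstanceAs (SheafOfModules.free (R := (Spec R).ringCatSheaf) PUnit.{1}).IsLocallyFree
  let t : (tilde.functor R).obj (ModuleCat.of R (PUnit.{1} →₀ R)) ≅ fr := tildeFinsupp PUnit.{1}
  let e : ModuleCat.of R (PUnit.{1} →₀ R) ≅ ModuleCat.of R R :=
    (Finsupp.uniqueLinearEquiv R R PUnit.unit.{1}).toModuleIso
  exact isLocallyFree_of_iso (t.symm ≪≫ (tilde.functor R).mapIso e) h

end Perfect

section Coherent

variable {R : CommRingCat.{0}} [IsNoetherianRing R]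

section

variable (W : ObjectProperty (DerivedCategory (Coh R)))
  [W.IsTriangulated] [W.IsClosedUnderIsomorphisms]

/-- The property of a finitely generated module that its associated coherent sheaf, as an object of
the derived category, satisfies `W`. -/
def moduleProp (N : Type) [AddCommGroup N] [Module R N] [Module.Finite R N] : Prop :=
  W ((DerivedCategory.singleFunctor (Coh R) 0).obj (cohOf R N))

lemma moduleProp_of_subsingleton (N : Type) [AddCommGroup N] [Module R N] [Module.Finite R N]
    [Subsingleton N] : moduleProp W N := by
  refine W.prop_of_isZero ((DerivedCategory.singleFunctor (Coh R) 0).map_isZero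
    ((tildeFG R).map_isZero ((IsZero.iff_id_eq_zero _).2 (FGModuleCat.hom_ext ?_))))
  exact LinearMap.ext fun n ↦ Subsingleton.elim (α := N) _ _

variable {M N L : Type} [AddCommGroup M] [Module R M] [Module.Finite R M]
  [AddCommGroup N] [Module R N] [Module.Finite R N] [AddCommGroup L] [Module R L]
  [Module.Finite R L] (f : M →ₗ[R] N) (g : N →ₗ[R] L)

lemma moduleProp_middle (hf : Function.Injective f) (hg : Function.Surjective g)
    (hfg : Function.Exact f g) (hM : moduleProp W M) (hL : moduleProp W L) : moduleProp W N :=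
  W.ext_of_isTriangulatedClosed₂ _ (shortExact_coh f g hfg.linearMap_comp_eq_zero hf hfg
    hg).singleTriangle_distinguished hM hL

lemma moduleProp_right (hf : Function.Injective f) (hg : Function.Surjective g)
    (hfg : Function.Exact f g) (hM : moduleProp W M) (hN : moduleProp W N) : moduleProp W L :=
  W.ext_of_isTriangulatedClosed₃ _ (shortExact_coh f g hfg.linearMap_comp_eq_zero hf hfg
    hg).singleTriangle_distinguished hM hN

lemma prop_of_moduleProp
    (hW : ∀ (N : Type) [AddCommGroup N] [Module R N] [Module.Finite R N], moduleProp W N)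
    (K : Db R) : W K.obj := by
  refine prop_of_bounded W (fun G ↦ ?_) K.obj K.property
  let N := (tildeFG R).objPreimage G
  exact W.prop_of_iso ((DerivedCategory.singleFunctor (Coh R) 0).mapIso
    ((tildeFG R).objObjPreimageIso G)) (@hW N _ _ N.property)

end

/-- A triangulated subcategory of the quotient is pulled back to the bounded derived category and
then viewed in the full derived category. It contains the structure sheaf automatically, since
perfect objects become zero. Essential surjectivity of the quotient functor finishes the argument.
-/
lemma generates_of_moduleProp (G : Coh R)
    (h : ∀ W : ObjectProperty (DerivedCategory (Coh R)), W.IsTriangulated →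
      W.IsClosedUnderIsomorphisms → W ((DerivedCategory.singleFunctor (Coh R) 0).obj G) →
      moduleProp W R →
      ∀ (N : Type) [AddCommGroup N] [Module R N] [Module.Finite R N], moduleProp W N) :
    Generates (inDSg G) := by
  intro T hT hT' hG
  let q : Db R ⥤ DSg R := (isPerfect R).triangEnvelope.trW.Q
  let T' : ObjectProperty (Db R) := T.inverseImage q
  have : T'.IsTriangulated := inferInstanceAs (T.inverseImage q).IsTriangulated
  let W : ObjectProperty (DerivedCategory (Coh R)) := T'.map DerivedCategory.Bounded.ι
  have hW (K : Db R) (hK : T (q.obj K)) : W K.obj :=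
    ObjectProperty.prop_map_obj _ DerivedCategory.Bounded.ι hK
  have key := prop_of_moduleProp W (h W inferInstance inferInstance (hW (inDb G) hG)
    (hW (inDb (cohOf R R)) (T.prop_of_isZero
      (isZero_inDSg_of_isPerfect _ isPerfect_structureSheaf))))
  refine top_unique fun X _ ↦ ?_
  obtain ⟨K, ⟨e⟩⟩ : ∃ K, Nonempty (q.obj K ≅ X) :=
    ⟨_, ⟨q.objObjPreimageIso X⟩⟩
  obtain ⟨K', hK', ⟨i⟩⟩ := (ObjectProperty.prop_map_iff _ _ _).1 (key K)
  exact T.prop_of_iso (q.mapIso (DerivedCategory.Bounded.ι.preimageIso i) ≪≫ e) hK'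

end Coherent

lemma generates_F (hF : isCoherent X₂ F) : Generates (inDSg (R := .of A) ⟨F, hF⟩) := by
  refine generates_of_moduleProp (R := .of A) _ fun W _ _ hW hA ↦ ?_
  have hd : IsDevissage fun N _ _ _ ↦ moduleProp (R := .of A) W N :=
    { zero := fun N _ _ _ _ ↦ moduleProp_of_subsingleton (R := .of A) W N
      middle := fun N₁ N₂ N₃ _ _ _ _ _ _ _ _ _ f g hf hg hfg ↦
        moduleProp_middle (R := .of A) W f g hf hg hfg
      right := fun N₁ N₂ N₃ _ _ _ _ _ _ _ _ _ f g hf hg hfg ↦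
        moduleProp_right (R := .of A) W f g hf hg hfg }
  exact hd.holds hA (W.prop_of_iso
    ((DerivedCategory.singleFunctor _ 0).mapIso (rulingSheafIso hF).symm) hW)

end

end A1Singularity

theorem mainTheorem5 :
    ∃ hF : A1Singularity.isCoherent A1Singularity.X₂ A1Singularity.F,
      A1Singularity.rank A1Singularity.F = 1 ∧
      (∃ (ε : A1Singularity.O₂ ⟶ A1Singularity.F) (h₀ : A1Singularity.φ ≫ ε = 0)
          (h₁ : A1Singularity.φ ≫ A1Singularity.φ = 0),
        Epi ε ∧ (ShortComplex.mk A1Singularity.φ ε h₀).Exact ∧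
          (ShortComplex.mk A1Singularity.φ A1Singularity.φ h₁).Exact) ∧
      ¬ A1Singularity.isPerfect (.of A1Singularity.A)
          (A1Singularity.inDb ⟨A1Singularity.F, hF⟩) ∧
      ¬ IsZero (A1Singularity.inDSg (R := .of A1Singularity.A) ⟨A1Singularity.F, hF⟩) ∧
      A1Singularity.Generates
        (A1Singularity.inDSg (R := .of A1Singularity.A) ⟨A1Singularity.F, hF⟩) :=
  ⟨A1Singularity.isCoherent_F, A1Singularity.rank_F, A1Singularity.exists_resolution_F,
    fun h ↦ A1Singularity.not_isZero_inDSg_F A1Singularity.isCoherent_F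
      (A1Singularity.isZero_inDSg_of_isPerfect _ h),
    A1Singularity.not_isZero_inDSg_F A1Singularity.isCoherent_F,
    A1Singularity.generates_F A1Singularity.isCoherent_F⟩
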